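/- Let $(\mathcal M,g)$ be a $d$-dimensional Riemannian manifold, $x\in\mathcal M$, and write $\langle\cdot,\cdot\rangle_x$ for the inner product on $\mathrm T_x\mathcal M$. Let $B\subset \mathrm T_x\mathcal M$ be a subspace of dimension $\ell$ (all probabilities below are understood conditionally on $B$, so $B$ is fixed), and let $\mathcal F:B\to \mathrm T_x\mathcal M$ be a random linear map with range $\Xi:=\operatorname{range}(\mathcal F)$. Suppose that $\mathcal F$ satisfies the Gaussian sketching condition: the real random variables $\langle \mathcal F[u],w\rangle_x$, $u\in B$, $w\in\mathrm T_x\mathcal M$, are jointly Gaussian, with $$\mathbb E\big[\langle \mathcal F[u],w\rangle_x\big]=0,\qquad \mathbb E\big[\langle \mathcal F[u],w\rangle_x\langle \mathcal F[v],z\rangle_x\big]=\langle u,v\rangle_x\langle w,z\rangle_x\qquad (u,v\in B,\ w,z\in \mathrm T_x\mathcal M)$$ (equivalently, the coefficients of $\mathcal F$ in orthonormal bases of $B$ and $\mathrm T_x\mathcal M$ are i.i.d. standard normal). If $d>\ell+1$, then $\mathcal F$ satisfies the Haar--Grassmann sketching condition: (i) $\Xi$ is Haar-uniform on the Grassmann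 manifold $\mathrm{Gr}(\ell,\mathrm T_x\mathcal M)$ of $\ell$-dimensional subspaces, i.e. its law is the probability measure on $\mathrm{Gr}(\ell,\mathrm T_x\mathcal M)$ that is invariant under all linear isometries of $\mathrm T_x\mathcal M$. (ii) Almost surely $\operatorname{rank}(\mathcal F)=\ell$, so that $\mathcal F$ has a unique polar decomposition $\mathcal F=\mathcal U\mathcal R$ with $\mathcal U:B\to\Xi$ a linear isometry and $\mathcal R:B\to B$ self-adjoint and positive definite. Conditionally on $\Xi$, the isometry $\mathcal U$ is Haar-uniform on the set $\mathrm{Iso}(B,\Xi)$ of linear isometries from $B$ to $\Xi$, i.e. its conditional law is the probability measure on $\mathrm{Iso}(B,\Xi)$ that is invariant under right composition with the linear isometries of $B$; and $\mathcal U$ is independent of $\mathcal R$. (iii) $\mathbb E[\mathcal R^2]=d\,\mathrm{Id}_B$ and $\mathbb E\big[\|\mathcal R^{-1}\|_{\mathrm{op}}^2\big]<\infty$. -/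

import Mathlib

open MeasureTheory ProbabilityTheory Module
open scoped InnerProductSpace Manifold ContDiff Bundle

namespace Sketching

section Defs

variable {V : Type*} [NormedAddCommGroup V] [InnerProductSpace ℝ V] [FiniteDimensional ℝ V]
variable {B : Type*} [NormedAddCommGroup B] [InnerProductSpace ℝ B] [FiniteDimensional ℝ B]

/-- The Borel `σ`-algebra on the set of subspaces of `V`, where a subspace `W` is identified with
the orthogonal projection onto `W`. On the subspaces of a given dimension this is the Borel
`σ`-algebra of the Grassmann manifold. -/
noncomputable instance subspaceMeasurableSpace : MeasurableSpace (Submodule ℝ V) :=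
  MeasurableSpace.comap (fun W : Submodule ℝ V => (W.starProjection : V →L[ℝ] V)) inferInstance

variable (V) in
/-- The Grassmann manifold `Gr(ℓ, V)`: the set of all `ℓ`-dimensional subspaces of `V`. -/
def Gr (ℓ : ℕ) : Set (Submodule ℝ V) := {W | finrank ℝ W = ℓ}

/-- `ν` is the Haar-uniform law on `Gr(ℓ, V)`: the probability measure carried by `Gr(ℓ, V)` that is
invariant under all linear isometries of `V` (which act transitively on `Gr(ℓ, V)`). -/
structure IsHaarUniformGr (ℓ : ℕ) (ν : Measure (Submodule ℝ V)) : Prop where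
  isProbabilityMeasure : IsProbabilityMeasure ν
  ae_mem : ∀ᵐ W ∂ν, W ∈ Gr V ℓ
  map_eq : ∀ Q : V ≃ₗᵢ[ℝ] V,
    ν.map (fun W : Submodule ℝ V => W.map Q.toLinearEquiv.toLinearMap) = ν

variable (B) in
/-- `Iso(B, W)`: the set of all linear isometries from `B` to `W` (for `dim B = dim W`), seen as
maps into the ambient space `V`. -/
def Iso (W : Submodule ℝ V) : Set (B →L[ℝ] V) :=
  {U | (∀ u : B, ‖U u‖ = ‖u‖) ∧ LinearMap.range (U : B →ₗ[ℝ] V) = W}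

variable (B) in
/-- `μ` is the Haar-uniform law on `Iso(B, W)`: the probability measure carried by `Iso(B, W)` that
is invariant under composition on the right with all linear isometries of `B` (which act simply
transitively on `Iso(B, W)`). -/
structure IsHaarUniformIso (W : Submodule ℝ V) (μ : Measure (B →L[ℝ] V)) : Prop where
  isProbabilityMeasure : IsProbabilityMeasure μ
  ae_mem : ∀ᵐ U ∂μ, U ∈ Iso B W
  map_eq : ∀ O : B ≃ₗᵢ[ℝ] B,
    μ.map (fun U : B →L[ℝ] V => U ∘L (O.toContinuousLinearEquiv : B →L[ℝ] B)) = μ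

/-- `F = U R` is a polar decomposition of `F : B → W`, `W = range F`: the factor `U` is a linear
isometry from `B` to `range F`, and `R` is a self-adjoint positive definite operator on `B`.
(Such `U` and `R` exist if and only if `F` is injective, and then they are unique.) -/
structure IsPolarDecomposition (F U : B →L[ℝ] V) (R : B →L[ℝ] B) : Prop where
  eq_comp : F = U ∘L R
  mem_iso : U ∈ Iso B (LinearMap.range (F : B →ₗ[ℝ] V))
  selfAdjoint : ∀ u v : B, ⟪R u, v⟫_ℝ = ⟪u, R v⟫_ℝ
  posDef : ∀ u : B, u ≠ 0 → 0 < ⟪R u, u⟫_ℝ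

variable {Ω : Type*} [MeasurableSpace Ω]

/-- The Gaussian sketching condition for the random linear map `F` on the space `B` (a subspace of
`V`, with the induced inner product). -/
structure GaussianSketching (P : Measure Ω) (F : Ω → B →L[ℝ] V) : Prop where
  gaussian : IsGaussianProcess (fun (p : B × V) (s : Ω) => ⟪F s p.1, p.2⟫_ℝ) P
  mean : ∀ (u : B) (w : V), ∫ s, ⟪F s u, w⟫_ℝ ∂P = 0
  covariance : ∀ (u v : B) (w z : V),
    ∫ s, ⟪F s u, w⟫_ℝ * ⟪F s v, z⟫_ℝ ∂P = ⟪u, v⟫_ℝ * ⟪w, z⟫_ℝ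

/-- The random subspace `Ξ = range F`. -/
def sketchRange (F : Ω → B →L[ℝ] V) (s : Ω) : Submodule ℝ V :=
  LinearMap.range (F s : B →ₗ[ℝ] V)

/-- The Haar-Grassmann sketching condition for the random linear map `F` on the space `B` (a
subspace of `V`, with the induced inner product), where `Ξ = range F`. The polar
factors `U` and `R` of `F` are determined almost surely by `F`; the law of `U` conditionally on `Ξ`
is its regular conditional distribution `condDistrib U Ξ P`. -/
structure HaarGrassmannSketching (P : Measure Ω) [IsProbabilityMeasure P]
    (F : Ω → B →L[ℝ] V) : Prop where
  aemeasurable_range : AEMeasurable (sketchRange F) P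
  haar_range : IsHaarUniformGr (finrank ℝ B) (P.map (sketchRange F))
  rank_eq : ∀ᵐ s ∂P, finrank ℝ (LinearMap.range (F s : B →ₗ[ℝ] V)) = finrank ℝ B
  polar : ∃ (U : Ω → B →L[ℝ] V) (R : Ω → B →L[ℝ] B),
    AEMeasurable U P ∧ AEMeasurable R P ∧
    (∀ᵐ s ∂P, IsPolarDecomposition (F s) (U s) (R s)) ∧
    (∀ᵐ W ∂(P.map (sketchRange F)),
      IsHaarUniformIso B W (condDistrib U (sketchRange F) P W)) ∧
    IndepFun U R P ∧
    Integrable (fun s => R s ∘L R s) P ∧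
    ∫ s, R s ∘L R s ∂P = (finrank ℝ V : ℝ) • ContinuousLinearMap.id ℝ B ∧
    Integrable (fun s => ‖(R s).inverse‖ ^ 2) P

end Defs

instance tangentSpaceFiniteDimensional {d : ℕ} {M : Type*} [TopologicalSpace M]
    [ChartedSpace (EuclideanSpace ℝ (Fin d)) M] (x : M) :
    FiniteDimensional ℝ (TangentSpace (𝓡 d) x) :=
  inferInstanceAs (FiniteDimensional ℝ (EuclideanSpace ℝ (Fin d)))

end Sketching

set_option linter.unusedSectionVars false

/-! A centred Gaussian law is determined by its covariance, so `Q F O` has the same law as `F` for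
all linear isometries `Q` of `V` and `O` of `B`. If `F = U R`, then `Q F O = (Q U O)(O⁻¹ R O)`.
Uniqueness of the polar decomposition therefore turns this invariance into one of the triple `(Ξ, U,
R)` (`GaussianSketching.map_polar_comp_isometry`), and the distributional claims are read off from
it. Taking `O = 1` gives invariance of the law of `Ξ`. Taking `Q = 1` leaves `Ξ` fixed and sends `U`
to `U O`, which is right invariance of the conditional law. With `O = 1` again, `(Q U, R)` and `(U,
R)` have the same law. Left translations act transitively on isometric maps, so the left-invariant
probability measure is unique and conditioning on `R` cannot change the law of `U`
(`indepFun_of_left_invariant`).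

Since `R² = F* F`, the second moment is a covariance computation. The inverse moment carries the
dimension hypothesis. In an orthonormal basis `b` of `B`, `sup 1/‖F u‖²` over unit `u` is at most
the sum over `i` of `1/dist(F bᵢ, F(bᵢ^⊥))²`. Given `F` on `bᵢ^⊥`, that distance is the norm of a
Gaussian vector in a space of dimension at least `d - ℓ + 1 ≥ 3`, where the inverse square is
integrable. Its finiteness also gives injectivity almost surely. -/

namespace Sketching

/-! ### Gaussian sketches: the law and its invariances. -/

section Gaussian

variable {V : Type*} [NormedAddCommGroup V] [InnerProductSpace ℝ V] [FiniteDimensional ℝ V]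
variable {B : Type*} [NormedAddCommGroup B] [InnerProductSpace ℝ B] [FiniteDimensional ℝ B]
variable {Ω Ω' : Type*} [MeasurableSpace Ω] [MeasurableSpace Ω']
variable {P : Measure Ω} {F : Ω → B →L[ℝ] V} {P' : Measure Ω'} {F' : Ω' → B →L[ℝ] V}

/-- The coefficient `A ↦ ⟪A u, w⟫`, as a continuous linear functional. -/
noncomputable def coeff (u : B) (w : V) : (B →L[ℝ] V) →L[ℝ] ℝ :=
  (innerSL ℝ w) ∘L (ContinuousLinearMap.apply ℝ V u)

@[simp] lemma coeff_apply (u : B) (w : V) (A : B →L[ℝ] V) : coeff u w A = ⟪A u, w⟫_ℝ := by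
  simp [coeff, real_inner_comm]

lemma eq_sum_coeff {ι κ : Type*} [Fintype ι] [Fintype κ] (b : OrthonormalBasis ι ℝ B)
    (f : OrthonormalBasis κ ℝ V) (A : B →L[ℝ] V) :
    A = ∑ p : ι × κ, ⟪A (b p.1), f p.2⟫_ℝ • (innerSL ℝ (b p.1)).smulRight (f p.2) := by
  ext u
  have h : A u = ∑ i, ⟪b i, u⟫_ℝ • A (b i) := by
    conv_lhs => rw [← b.sum_repr' u]
    simp
  rw [h, Fintype.sum_prod_type]
  simp only [sum_apply, smul_apply,
    ContinuousLinearMap.smulRight_apply, innerSL_apply_apply]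
  refine Finset.sum_congr rfl fun i _ => ?_
  conv_lhs => rw [← f.sum_repr' (A (b i)), Finset.smul_sum]
  refine Finset.sum_congr rfl fun j _ => ?_
  rw [smul_comm, real_inner_comm]

lemma GaussianSketching.hasGaussianLaw (hF : GaussianSketching P F) : HasGaussianLaw F P := by
  classical
  let b := stdOrthonormalBasis ℝ B
  let f := stdOrthonormalBasis ℝ V
  let I : Finset (B × V) := Finset.univ.image fun p : Fin (finrank ℝ B) × Fin (finrank ℝ V) =>
    (b p.1, f p.2)
  have hI (p : Fin (finrank ℝ B) × Fin (finrank ℝ V)) : (b p.1, f p.2) ∈ I :=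
    Finset.mem_image_of_mem _ (Finset.mem_univ p)
  let T : (I → ℝ) →L[ℝ] (B →L[ℝ] V) := ∑ p, (ContinuousLinearMap.proj (R := ℝ)
    (φ := fun _ : I => ℝ) ⟨(b p.1, f p.2), hI p⟩).smulRight
      ((innerSL ℝ (b p.1)).smulRight (f p.2))
  have h := (hF.gaussian.hasGaussianLaw I).map T
  have hT : F = T ∘ fun s => I.restrict fun p : B × V => ⟪F s p.1, p.2⟫_ℝ := by
    ext1 s
    conv_lhs => rw [eq_sum_coeff b f (F s)]
    simp [T]
  rw [hT]
  exact h

lemma GaussianSketching.of_hasGaussianLaw (h : HasGaussianLaw F P)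
    (hm : ∀ (u : B) (w : V), ∫ s, ⟪F s u, w⟫_ℝ ∂P = 0)
    (hc : ∀ (u v : B) (w z : V),
      ∫ s, ⟪F s u, w⟫_ℝ * ⟪F s v, z⟫_ℝ ∂P = ⟪u, v⟫_ℝ * ⟪w, z⟫_ℝ) : GaussianSketching P F where
  gaussian := ⟨fun I => by
    have hI : (fun s => I.restrict fun p : B × V => ⟪F s p.1, p.2⟫_ℝ) =
        ContinuousLinearMap.pi (R := ℝ) (fun p : I => coeff p.1.1 p.1.2) ∘ F := by
      ext s p
      simp
    rw [hI]
    exact h.map _⟩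
  mean := hm
  covariance := hc

lemma GaussianSketching.memLp_coeff (hF : GaussianSketching P F) (u : B) (w : V) :
    MemLp (fun s => ⟪F s u, w⟫_ℝ) 2 P :=
  (hF.gaussian.hasGaussianLaw_eval (u, w)).memLp_two

/-- The right-hand sides involve neither the probability space nor the sketch, so any two Gaussian
sketches have the same mean and variance along every functional. -/
lemma GaussianSketching.integral_dual (hF : GaussianSketching P F)
    {ι κ : Type*} [Fintype ι] [Fintype κ] (b : OrthonormalBasis ι ℝ B)
    (f : OrthonormalBasis κ ℝ V) (L : StrongDual ℝ (B →L[ℝ] V)) :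
    ∫ s, L (F s) ∂P = 0 ∧ Var[fun s => L (F s); P] =
      ∑ p : ι × κ, ∑ q : ι × κ, L ((innerSL ℝ (b p.1)).smulRight (f p.2)) *
        L ((innerSL ℝ (b q.1)).smulRight (f q.2)) * (⟪b p.1, b q.1⟫_ℝ * ⟪f p.2, f q.2⟫_ℝ) := by
  have hP := hF.gaussian.isProbabilityMeasure
  have hL (s : Ω) : L (F s) = ∑ p : ι × κ, ⟪F s (b p.1), f p.2⟫_ℝ *
      L ((innerSL ℝ (b p.1)).smulRight (f p.2)) := by
    conv_lhs => rw [eq_sum_coeff b f (F s)]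
    simp
  have h0 : ∫ s, L (F s) ∂P = 0 := by
    simp_rw [hL]
    rw [integral_finsetSum _ fun p _ => ((hF.memLp_coeff _ _).integrable one_le_two).mul_const _]
    simp [integral_mul_const, hF.mean]
  refine ⟨h0, ?_⟩
  rw [variance_of_integral_eq_zero (hF.hasGaussianLaw.map_fun L).aemeasurable h0]
  have hsq (s : Ω) : (fun s => L (F s)) s ^ 2 = ∑ p : ι × κ, ∑ q : ι × κ,
      L ((innerSL ℝ (b p.1)).smulRight (f p.2)) *
        L ((innerSL ℝ (b q.1)).smulRight (f q.2)) *
        (⟪F s (b p.1), f p.2⟫_ℝ * ⟪F s (b q.1), f q.2⟫_ℝ) := by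
    simp only [hL, sq, Finset.sum_mul_sum]
    refine Finset.sum_congr rfl fun p _ => Finset.sum_congr rfl fun q _ => by ring
  have hi (p q : ι × κ) : Integrable (fun s => L ((innerSL ℝ (b p.1)).smulRight (f p.2)) *
        L ((innerSL ℝ (b q.1)).smulRight (f q.2)) *
        (⟪F s (b p.1), f p.2⟫_ℝ * ⟪F s (b q.1), f q.2⟫_ℝ)) P :=
    ((hF.memLp_coeff _ _).integrable_mul (hF.memLp_coeff _ _)).const_mul _
  simp_rw [hsq]
  rw [integral_finsetSum _ fun p _ => integrable_finsetSum _ fun q _ => hi p q]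
  refine Finset.sum_congr rfl fun p _ => ?_
  rw [integral_finsetSum _ fun q _ => hi p q]
  refine Finset.sum_congr rfl fun q _ => ?_
  rw [integral_const_mul, hF.covariance]

lemma GaussianSketching.map_eq (hF : GaussianSketching P F) (hF' : GaussianSketching P' F') :
    P.map F = P'.map F' := by
  have h := hF.hasGaussianLaw
  have h' := hF'.hasGaussianLaw
  have := h.isGaussian_map
  have := h'.isGaussian_map
  refine Measure.ext_of_charFunDual (funext fun L => ?_)
  obtain ⟨h1, h2⟩ := hF.integral_dual (stdOrthonormalBasis ℝ B) (stdOrthonormalBasis ℝ V) L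
  obtain ⟨h1', h2'⟩ := hF'.integral_dual (stdOrthonormalBasis ℝ B) (stdOrthonormalBasis ℝ V) L
  rw [h.charFunDual_map_eq_fun, h'.charFunDual_map_eq_fun, h1, h2, h1', h2']

lemma GaussianSketching.comp_isometry (hF : GaussianSketching P F) (Q : V ≃ₗᵢ[ℝ] V)
    (O : B ≃ₗᵢ[ℝ] B) : GaussianSketching P fun s =>
      (Q.toContinuousLinearEquiv : V →L[ℝ] V) ∘L F s ∘L
        (O.toContinuousLinearEquiv : B →L[ℝ] B) := by
  have h (s : Ω) (u : B) (w : V) : ⟪((Q.toContinuousLinearEquiv : V →L[ℝ] V) ∘L F s ∘L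
        (O.toContinuousLinearEquiv : B →L[ℝ] B)) u, w⟫_ℝ = ⟪F s (O u), Q.symm w⟫_ℝ := by
    have := Q.inner_map_map (F s (O u)) (Q.symm w)
    simpa using this
  refine .of_hasGaussianLaw ?_ (fun u w => ?_) fun u v w z => ?_
  · exact hF.hasGaussianLaw.map
      ((ContinuousLinearMap.compL ℝ B V V (Q.toContinuousLinearEquiv : V →L[ℝ] V)) ∘L
        ((ContinuousLinearMap.compL ℝ B B V).flip (O.toContinuousLinearEquiv : B →L[ℝ] B)))
  · simp_rw [h, hF.mean]
  · simp_rw [h, hF.covariance, LinearIsometryEquiv.inner_map_map]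

lemma GaussianSketching.map (hF : GaussianSketching P F) : GaussianSketching (P.map F) id := by
  have h := hF.hasGaussianLaw
  refine .of_hasGaussianLaw ⟨?_⟩ (fun u w => ?_) fun u v w z => ?_
  · rw [Measure.map_id]; exact h.isGaussian_map
  · have := integral_map h.aemeasurable (f := coeff u w) (by fun_prop)
    simpa [hF.mean] using this
  · have := integral_map h.aemeasurable (f := fun A => coeff u w A * coeff v z A) (by fun_prop)
    simpa [hF.covariance] using this

/-- Replacing the behaviour of a Gaussian sketch in the direction `e` by that of an independent
copy does not change its law. -/
lemma GaussianSketching.splice {μ : Measure (B →L[ℝ] V)} (hμ : GaussianSketching μ id) {e : B}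
    (he : ‖e‖ = 1) : GaussianSketching (μ.prod μ) fun p : (B →L[ℝ] V) × (B →L[ℝ] V) =>
      p.1 + (p.2 - p.1) ∘L (innerSL ℝ e).smulRight e := by
  have := hμ.gaussian.isProbabilityMeasure
  have hg := hμ.hasGaussianLaw
  have hgm : IsGaussian μ := by simpa using hg.isGaussian_map
  have hee : ⟪e, e⟫_ℝ = 1 := by rw [real_inner_self_eq_norm_sq, he]; norm_num
  have hmean (u : B) (w : V) : ∫ A, ⟪A u, w⟫_ℝ ∂μ = 0 := hμ.mean u w
  have hcov (u v : B) (w z : V) :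
    ∫ A, ⟪A u, w⟫_ℝ * ⟪A v, z⟫_ℝ ∂μ = ⟪u, v⟫_ℝ * ⟪w, z⟫_ℝ := hμ.covariance u v w z
  have hL2 (u : B) (w : V) : MemLp (fun A : B →L[ℝ] V => ⟪A u, w⟫_ℝ) 2 μ := hμ.memLp_coeff u w
  have hLi (u : B) (w : V) : Integrable (fun A : B →L[ℝ] V => ⟪A u, w⟫_ℝ) μ :=
    (hL2 u w).integrable one_le_two
  have hfst : MeasurePreserving Prod.fst (μ.prod μ) μ := measurePreserving_fst
  have hsnd : MeasurePreserving Prod.snd (μ.prod μ) μ := measurePreserving_snd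
  -- The spliced map acts as `p.1` on the orthogonal complement of `e` and as `p.2` on the line
  -- through `e`.
  have h (p : (B →L[ℝ] V) × (B →L[ℝ] V)) (u : B) (w : V) :
      ⟪(p.1 + (p.2 - p.1) ∘L (innerSL ℝ e).smulRight e) u, w⟫_ℝ =
        ⟪p.1 (u - ⟪e, u⟫_ℝ • e), w⟫_ℝ + ⟪p.2 (⟪e, u⟫_ℝ • e), w⟫_ℝ := by
    rw [← inner_add_left]
    congr 1
    simp
    abel
  refine .of_hasGaussianLaw ?_ (fun u w => ?_) fun u v w z => ?_
  · have h1 : HasGaussianLaw (Prod.fst : _ → B →L[ℝ] V) (μ.prod μ) :=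
      ⟨by rw [hfst.map_eq]; exact hgm⟩
    have h2 : HasGaussianLaw (Prod.snd : _ → B →L[ℝ] V) (μ.prod μ) :=
      ⟨by rw [hsnd.map_eq]; exact hgm⟩
    have h12 : IndepFun (Prod.fst : _ → B →L[ℝ] V) (Prod.snd : _ → B →L[ℝ] V) (μ.prod μ) :=
      indepFun_prod measurable_id measurable_id
    exact (h12.hasGaussianLaw h1 h2).map (ContinuousLinearMap.fst ℝ _ _ +
      ((ContinuousLinearMap.compL ℝ B B V).flip ((innerSL ℝ e).smulRight e)) ∘L
        (ContinuousLinearMap.snd ℝ _ _ - ContinuousLinearMap.fst ℝ _ _))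
  · simp_rw [h]
    have j1 (u w) : Integrable (fun p : (B →L[ℝ] V) × (B →L[ℝ] V) => ⟪p.1 u, w⟫_ℝ) (μ.prod μ) :=
      hfst.integrable_comp_of_integrable (hLi u w)
    have j2 (u w) : Integrable (fun p : (B →L[ℝ] V) × (B →L[ℝ] V) => ⟪p.2 u, w⟫_ℝ) (μ.prod μ) :=
      hsnd.integrable_comp_of_integrable (hLi u w)
    rw [integral_add (j1 ..) (j2 ..)]
    have h1 := integral_fun_fst (μ := μ) (ν := μ) fun A : B →L[ℝ] V =>
      ⟪A (u - ⟪e, u⟫_ℝ • e), w⟫_ℝ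
    have h2 := integral_fun_snd (μ := μ) (ν := μ) fun A : B →L[ℝ] V =>
      ⟪A (⟪e, u⟫_ℝ • e), w⟫_ℝ
    rw [h1, h2, hmean, hmean]
    simp
  · simp_rw [h, add_mul, mul_add]
    have i11 (u v w z) : Integrable (fun p : (B →L[ℝ] V) × (B →L[ℝ] V) =>
        ⟪p.1 u, w⟫_ℝ * ⟪p.1 v, z⟫_ℝ) (μ.prod μ) :=
      hfst.integrable_comp_of_integrable ((hL2 u w).integrable_mul (hL2 v z))
    have i22 (u v w z) : Integrable (fun p : (B →L[ℝ] V) × (B →L[ℝ] V) =>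
        ⟪p.2 u, w⟫_ℝ * ⟪p.2 v, z⟫_ℝ) (μ.prod μ) :=
      hsnd.integrable_comp_of_integrable ((hL2 u w).integrable_mul (hL2 v z))
    have i12 (u v w z) : Integrable (fun p : (B →L[ℝ] V) × (B →L[ℝ] V) =>
        ⟪p.1 u, w⟫_ℝ * ⟪p.2 v, z⟫_ℝ) (μ.prod μ) := (hLi u w).mul_prod (hLi v z)
    have i21 (u v w z) : Integrable (fun p : (B →L[ℝ] V) × (B →L[ℝ] V) =>
        ⟪p.2 u, w⟫_ℝ * ⟪p.1 v, z⟫_ℝ) (μ.prod μ) := by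
      simpa only [mul_comm] using i12 v u z w
    have e11 (u v w z) : ∫ p, ⟪p.1 u, w⟫_ℝ * ⟪p.1 v, z⟫_ℝ ∂(μ.prod μ) =
        ⟪u, v⟫_ℝ * ⟪w, z⟫_ℝ := by
      have := integral_fun_fst (μ := μ) (ν := μ) fun A : B →L[ℝ] V => ⟪A u, w⟫_ℝ * ⟪A v, z⟫_ℝ
      rw [this, hcov]; simp
    have e22 (u v w z) : ∫ p, ⟪p.2 u, w⟫_ℝ * ⟪p.2 v, z⟫_ℝ ∂(μ.prod μ) =
        ⟪u, v⟫_ℝ * ⟪w, z⟫_ℝ := by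
      have := integral_fun_snd (μ := μ) (ν := μ) fun A : B →L[ℝ] V => ⟪A u, w⟫_ℝ * ⟪A v, z⟫_ℝ
      rw [this, hcov]; simp
    have e12 (u v w z) : ∫ p, ⟪p.1 u, w⟫_ℝ * ⟪p.2 v, z⟫_ℝ ∂(μ.prod μ) = 0 := by
      rw [integral_prod_mul (fun A : B →L[ℝ] V => ⟪A u, w⟫_ℝ) fun A : B →L[ℝ] V => ⟪A v, z⟫_ℝ,
        hmean, zero_mul]
    have e21 (u v w z) : ∫ p, ⟪p.2 u, w⟫_ℝ * ⟪p.1 v, z⟫_ℝ ∂(μ.prod μ) = 0 := by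
      rw [← e12 v u z w]; exact integral_congr_ae (.of_forall fun p => mul_comm _ _)
    rw [integral_add, integral_add (i11 ..) (i12 ..), integral_add (i21 ..) (i22 ..),
      e11, e12, e21, e22]
    rotate_left
    · exact (i11 ..).add (i12 ..)
    · exact (i21 ..).add (i22 ..)
    -- The cross covariances vanish; what remains is the Pythagorean splitting of `⟪u, v⟫` along `e`
    -- and its complement.
    simp only [inner_sub_left, inner_sub_right, real_inner_smul_left, real_inner_smul_right, hee,
      real_inner_comm e u]
    ring

end Gaussian

/-! ### Finiteness of the inverse second moment. -/

section InverseMoment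

open scoped ENNReal

variable {V : Type*} [NormedAddCommGroup V] [InnerProductSpace ℝ V] [FiniteDimensional ℝ V]
variable {B : Type*} [NormedAddCommGroup B] [InnerProductSpace ℝ B] [FiniteDimensional ℝ B]

/-- The singularity at `0` is integrable because `2/3 < 1`. The exponent is `2/3` so that three such
factors make up an inverse square. -/
lemma lintegral_enorm_rpow_gaussianReal_lt_top :
    ∫⁻ x, ‖x‖ₑ ^ (-(2 / 3) : ℝ) ∂(gaussianReal 0 1) < ⊤ := by
  have hint : Integrable fun x : ℝ => |x| ^ (-(2 / 3) : ℝ) * Real.exp (-(1 / 2) * x ^ 2) := by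
    have h := integrable_rpow_mul_exp_neg_mul_sq (b := 1 / 2) (by norm_num)
      (s := -(2 / 3)) (by norm_num)
    have h2 := h.integrableOn (s := Set.Ioi 0)
    have h3 : IntegrableOn (fun x : ℝ => |x| ^ (-(2 / 3) : ℝ) * Real.exp (-(1 / 2) * |x| ^ 2))
        (Set.Ioi 0) := by
      refine h2.congr_fun (fun x hx => ?_) measurableSet_Ioi
      simp only [abs_of_pos (Set.mem_Ioi.1 hx)]
    simp only [sq_abs] at h3
    rw [← integrableOn_univ, ← @Set.Iio_union_Ici _ _ (0 : ℝ), integrableOn_union,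
      integrableOn_Ici_iff_integrableOn_Ioi]
    refine ⟨?_, h3⟩
    rw [← (Measure.measurePreserving_neg (volume : Measure ℝ)).integrableOn_comp_preimage
      (Homeomorph.neg ℝ).measurableEmbedding]
    simpa [Function.comp_def] using h3
  rw [gaussianReal_of_var_ne_zero _ one_ne_zero,
    lintegral_withDensity_eq_lintegral_mul₀ (by fun_prop) (by fun_prop)]
  refine lt_of_le_of_lt (lintegral_mono_ae ?_) (hint.const_mul (√(2 * Real.pi))⁻¹).2
  -- The origin has to be discarded: there the extended power is `⊤` while the real power is `0`.
  filter_upwards [compl_mem_ae_iff.2 (measure_singleton (0 : ℝ))] with x hx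
  have hx : 0 < |x| := abs_pos.2 (by simpa using hx)
  have hx' : ‖x‖ₑ = ENNReal.ofReal |x| := by rw [← Real.norm_eq_abs, ofReal_norm]
  rw [Pi.mul_apply, hx', ENNReal.ofReal_rpow_of_pos hx, gaussianPDF, gaussianPDFReal,
    ← ENNReal.ofReal_mul (by positivity), Real.enorm_eq_ofReal (by positivity)]
  refine ENNReal.ofReal_le_ofReal (le_of_eq ?_)
  simp
  ring_nf

lemma inv_sq_le_prod_rpow {t : ℝ≥0∞} {a : Fin 3 → ℝ≥0∞} (h : ∀ k, a k ≤ t) :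
    (t ^ 2)⁻¹ ≤ ∏ k, a k ^ (-(2 / 3) : ℝ) := by
  have : (t ^ 2)⁻¹ = ∏ _k : Fin 3, t ^ (-(2 / 3) : ℝ) := by
    rw [Finset.prod_const, ← ENNReal.rpow_natCast, ← ENNReal.rpow_natCast, ← ENNReal.rpow_mul,
      ← ENNReal.rpow_neg]
    norm_num
  rw [this]
  exact Finset.prod_le_prod' fun k _ => by
    rw [ENNReal.rpow_neg, ENNReal.rpow_neg]
    exact ENNReal.inv_le_inv.2 (ENNReal.rpow_le_rpow (h k) (by norm_num))

variable {μ : Measure (B →L[ℝ] V)}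

lemma GaussianSketching.map_coeff (hμ : GaussianSketching μ id) {e : B} (he : ‖e‖ = 1) {w : V}
    (hw : ‖w‖ = 1) : μ.map (coeff e w) = gaussianReal 0 1 := by
  have h : HasGaussianLaw (coeff e w) μ := hμ.hasGaussianLaw.map (coeff e w)
  have h0 : ∫ A, coeff e w A ∂μ = 0 := by simpa using hμ.mean e w
  rw [h.map_eq_gaussianReal, variance_of_integral_eq_zero h.aemeasurable h0, h0]
  have := hμ.covariance e e w w
  simp only [real_inner_self_eq_norm_sq, he, hw, id] at this
  simp [sq, this]

/-- Coefficients along orthonormal directions are jointly Gaussian and uncorrelated, hence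
independent, and the integral factorises. Its value does not depend on the choice of `w`. -/
lemma GaussianSketching.lintegral_prod_coeff (hμ : GaussianSketching μ id) {e : B}
    (he : ‖e‖ = 1) {w : Fin 3 → V} (hw : Orthonormal ℝ w) :
    ∫⁻ A, ∏ k, ‖⟪A e, w k⟫_ℝ‖ₑ ^ (-(2 / 3) : ℝ) ∂μ =
      (∫⁻ x, ‖x‖ₑ ^ (-(2 / 3) : ℝ) ∂(gaussianReal 0 1)) ^ 3 := by
  have h : HasGaussianLaw (fun A : B →L[ℝ] V => fun k => coeff e (w k) A) μ :=
    hμ.hasGaussianLaw.map (ContinuousLinearMap.pi fun k => coeff e (w k))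
  have h0 (k) : ∫ A, coeff e (w k) A ∂μ = 0 := by simpa using hμ.mean e (w k)
  have hind : iIndepFun (fun k => (coeff e (w k) : (B →L[ℝ] V) → ℝ)) μ := by
    refine h.iIndepFun_of_covariance_eq_zero fun i j hij => ?_
    have := hμ.covariance e e (w i) (w j)
    rw [hw.2 hij, mul_zero] at this
    unfold ProbabilityTheory.covariance
    rw [h0, h0]
    simpa using this
  have := (hind.comp (fun _ x => ‖x‖ₑ ^ (-(2 / 3) : ℝ)) fun _ => by fun_prop)
  have := lintegral_prod_eq_prod_lintegral_of_indepFun Finset.univ _ this fun _ => by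
    simp only [Function.comp_def]; fun_prop
  simp only [Function.comp_def, coeff_apply] at this
  rw [this, ← Fin.prod_const]
  refine Finset.prod_congr rfl fun k _ => ?_
  rw [← hμ.map_coeff he (hw.1 k), lintegral_map (by fun_prop) (by fun_prop)]
  simp

/-- The supremum of `1 / ‖A u‖ ^ 2` over the vectors `u` with `⟪e, u⟫ = 1`. -/
noncomputable def invDistSq (e : B) (A : B →L[ℝ] V) : ℝ≥0∞ :=
  ⨆ (u : B) (_ : ⟪e, u⟫_ℝ = 1), (‖A u‖ₑ ^ 2)⁻¹

/-- The supremum of `1 / ‖A u‖ ^ 2` over the unit vectors `u`. -/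
noncomputable def invNormSq (A : B →L[ℝ] V) : ℝ≥0∞ :=
  ⨆ (u : B) (_ : ‖u‖ = 1), (‖A u‖ₑ ^ 2)⁻¹

/-- The supremum is uncountable, but a supremum of continuous functions is lower semicontinuous. -/
lemma measurable_invDistSq (e : B) : Measurable (invDistSq e : (B →L[ℝ] V) → ℝ≥0∞) :=
  (lowerSemicontinuous_iSup fun u => lowerSemicontinuous_iSup fun _ =>
    Continuous.lowerSemicontinuous (by fun_prop)).measurable

/-- The image of the complement of `e` has dimension at most `ℓ - 1`, so its orthogonal complement
has dimension at least `d - ℓ + 1 ≥ 3`. This is where `d > ℓ + 1` enters. -/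
lemma exists_orthonormal_three_orthogonal (hd : finrank ℝ B + 1 < finrank ℝ V)
    (A : B →L[ℝ] V) {e : B} (he : ‖e‖ = 1) :
    ∃ w : Fin 3 → V, Orthonormal ℝ w ∧ ∀ v : B, ⟪e, v⟫_ℝ = 0 → ∀ k, ⟪A v, w k⟫_ℝ = 0 := by
  let W : Submodule ℝ V := (ℝ ∙ e)ᗮ.map (A : B →ₗ[ℝ] V)
  have h1 : finrank ℝ W ≤ finrank ℝ (ℝ ∙ e)ᗮ := Submodule.finrank_map_le _ _
  have h2 := (ℝ ∙ e).finrank_add_finrank_orthogonal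
  rw [finrank_span_singleton (by rintro rfl; simp at he)] at h2
  have h3 := W.finrank_add_finrank_orthogonal
  have h4 : 3 ≤ finrank ℝ Wᗮ := by omega
  let b := stdOrthonormalBasis ℝ Wᗮ
  refine ⟨fun k => b (Fin.castLE h4 k), ?_, fun v hv k => ?_⟩
  · have := (b.orthonormal.comp _ (Fin.castLE_injective h4))
    exact this.comp_linearIsometry Wᗮ.subtypeₗᵢ
  · exact (b (Fin.castLE h4 k)).2 _
      (Submodule.mem_map_of_mem (Submodule.mem_orthogonal_singleton_iff_inner_right.2 hv))

/-- After splicing in an independent copy `A'` along `e`, fix `A`. If `⟪e, u⟫ = 1`, the spliced map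
sends `u` to `A (u - e) + A' e`, whose coefficients along the three directions orthogonal to `A
(e^⊥)` are those of `A' e`. The norm thus dominates three independent standard normals. The
directions depend on `A`, the resulting bound does not. -/
lemma GaussianSketching.lintegral_invDistSq_lt_top (hμ : GaussianSketching μ id)
    (hd : finrank ℝ B + 1 < finrank ℝ V) {e : B} (he : ‖e‖ = 1) :
    ∫⁻ A, invDistSq e A ∂μ < ⊤ := by
  have := hμ.gaussian.isProbabilityMeasure
  have hs := hμ.splice he
  have hmap := hμ.map_eq hs
  rw [Measure.map_id] at hmap
  have hm : Measurable fun p : (B →L[ℝ] V) × (B →L[ℝ] V) =>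
    p.1 + (p.2 - p.1) ∘L (innerSL ℝ e).smulRight e :=
    Continuous.measurable (by fun_prop)
  rw [hmap, lintegral_map (measurable_invDistSq e) hm,
    lintegral_prod (fun p => invDistSq e (p.1 + (p.2 - p.1) ∘L (innerSL ℝ e).smulRight e))
      ((measurable_invDistSq e).comp hm).aemeasurable]
  refine lt_of_le_of_lt (lintegral_mono fun A => ?_)
    (b := ∫⁻ _, (∫⁻ x, ‖x‖ₑ ^ (-(2 / 3) : ℝ) ∂(gaussianReal 0 1)) ^ 3 ∂μ) ?_
  · obtain ⟨w, hw, hAw⟩ := exists_orthonormal_three_orthogonal hd A he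
    rw [← hμ.lintegral_prod_coeff he hw]
    refine lintegral_mono fun A' => iSup₂_le fun u hu => inv_sq_le_prod_rpow fun k => ?_
    have hee : ⟪e, e⟫_ℝ = 1 := by rw [real_inner_self_eq_norm_sq, he]; norm_num
    have hv : ⟪(A + (A' - A) ∘L (innerSL ℝ e).smulRight e) u, w k⟫_ℝ = ⟪A' e, w k⟫_ℝ := by
      have h1 : (A + (A' - A) ∘L (innerSL ℝ e).smulRight e) u = A (u - e) + A' e := by
        simp [hu]
        abel
      rw [h1, inner_add_left, hAw _ (by rw [inner_sub_right, hu, hee, sub_self]), zero_add]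
    rw [← hv, enorm_le_iff_norm_le]
    simpa [hw.1 k] using norm_inner_le_norm (𝕜 := ℝ)
      ((A + (A' - A) ∘L (innerSL ℝ e).smulRight e) u) (w k)
  · simpa using ENNReal.pow_lt_top (n := 3) lintegral_enorm_rpow_gaussianReal_lt_top

/-- Write `1 = ∑ ⟪b i, u⟫²` and, in each nonzero term, rescale `u` so that its `i`-th coordinate is
`1`. -/
lemma invNormSq_le_sum {ι : Type*} [Fintype ι] (b : OrthonormalBasis ι ℝ B)
    (A : B →L[ℝ] V) : invNormSq A ≤ ∑ i, invDistSq (b i) A := by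
  refine iSup₂_le fun u hu => ?_
  have h1 : ∑ i, ‖⟪b i, u⟫_ℝ‖ₑ ^ 2 = 1 := by
    have := b.sum_sq_norm_inner_right u
    have h (i) : ‖⟪b i, u⟫_ℝ‖ₑ ^ 2 = ENNReal.ofReal (‖⟪b i, u⟫_ℝ‖ ^ 2) := by
      rw [ENNReal.ofReal_pow (norm_nonneg _), ofReal_norm]
    simp_rw [h]
    rw [← ENNReal.ofReal_sum_of_nonneg fun i _ => by positivity, this, hu]
    simp
  rw [← one_mul (‖A u‖ₑ ^ 2)⁻¹, ← h1, Finset.sum_mul]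
  refine Finset.sum_le_sum fun i _ => ?_
  rcases eq_or_ne ⟪b i, u⟫_ℝ 0 with h0 | h0
  · simp [h0]
  · refine le_iSup₂_of_le ((⟪b i, u⟫_ℝ)⁻¹ • u)
      (by rw [inner_smul_right]; exact inv_mul_cancel₀ h0) ?_
    rw [map_smul, enorm_smul, enorm_inv h0, mul_pow, ENNReal.mul_inv, ← ENNReal.inv_pow, inv_inv]
    · left; simp
    · left; simp [h0]

lemma GaussianSketching.lintegral_invNormSq_lt_top (hμ : GaussianSketching μ id)
    (hd : finrank ℝ B + 1 < finrank ℝ V) : ∫⁻ A, invNormSq A ∂μ < ⊤ := by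
  refine (lintegral_mono fun A => invNormSq_le_sum (stdOrthonormalBasis ℝ B) A).trans_lt ?_
  rw [lintegral_finsetSum _ fun i _ => measurable_invDistSq _]
  exact ENNReal.sum_lt_top.2 fun i _ =>
    hμ.lintegral_invDistSq_lt_top hd ((stdOrthonormalBasis ℝ B).norm_eq_one i)

lemma measurable_invNormSq : Measurable (invNormSq : (B →L[ℝ] V) → ℝ≥0∞) :=
  (lowerSemicontinuous_iSup fun u => lowerSemicontinuous_iSup fun _ =>
    Continuous.lowerSemicontinuous (by fun_prop)).measurable

lemma norm_sq_le_invNormSq_mul {A : B →L[ℝ] V} (h : invNormSq A < ⊤) (u : B) :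
    ‖u‖ ^ 2 ≤ (invNormSq A).toReal * ‖A u‖ ^ 2 := by
  rcases eq_or_ne u 0 with rfl | hu
  · simp
  have hu' : ‖u‖ ≠ 0 := norm_ne_zero_iff.2 hu
  have h1 : (‖A (‖u‖⁻¹ • u)‖ₑ ^ 2)⁻¹ ≤ invNormSq A :=
    le_iSup₂_of_le (‖u‖⁻¹ • u) (by rw [norm_smul, norm_inv, norm_norm, inv_mul_cancel₀ hu']) le_rfl
  -- The inverse of `0` is `⊤`, so a finite supremum excludes kernel vectors.
  have h2 : ‖A (‖u‖⁻¹ • u)‖ₑ ≠ 0 := by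
    intro h0
    rw [h0] at h1
    simp at h1
    exact h.ne h1
  have h3 := ENNReal.toReal_mono h.ne h1
  rw [ENNReal.toReal_inv, ENNReal.toReal_pow, toReal_enorm, map_smul, norm_smul, norm_inv,
    norm_norm] at h3
  have h4 : 0 < ‖A u‖ := by
    refine norm_pos_iff.2 fun h0 => h2 ?_
    simp [h0]
  rw [mul_pow, mul_inv, inv_pow, inv_inv] at h3
  have := mul_le_mul_of_nonneg_right h3 (sq_nonneg ‖A u‖)
  rwa [mul_assoc, inv_mul_cancel₀ (by positivity), mul_one] at this

lemma injective_of_invNormSq_lt_top {A : B →L[ℝ] V} (h : invNormSq A < ⊤) :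
    Function.Injective A := by
  refine (injective_iff_map_eq_zero A).2 fun u hu => ?_
  have := norm_sq_le_invNormSq_mul h u
  rw [hu, norm_zero] at this
  simpa using this

end InverseMoment

/-! ### Polar decomposition: existence, uniqueness, measurability. -/

section Polar

variable {V : Type*} [NormedAddCommGroup V] [InnerProductSpace ℝ V] [FiniteDimensional ℝ V]
variable {B : Type*} [NormedAddCommGroup B] [InnerProductSpace ℝ B] [FiniteDimensional ℝ B]

/-- With `D = R - S`, equality of the squares gives `R D + D S = 0`. Pairing with an eigenvector `e`
of `D` of eigenvalue `c` gives `c (⟪R e, e⟫ + ⟪S e, e⟫) = 0`. Either `c = 0`, or both nonnegative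
terms vanish and then `⟪D e, e⟫ = 0`, so `D e = 0` in either case. -/
lemma eq_of_comp_self_eq {R S : B →L[ℝ] B} (hR : ∀ u v : B, ⟪R u, v⟫_ℝ = ⟪u, R v⟫_ℝ)
    (hR0 : ∀ u : B, 0 ≤ ⟪R u, u⟫_ℝ) (hS : ∀ u v : B, ⟪S u, v⟫_ℝ = ⟪u, S v⟫_ℝ)
    (hS0 : ∀ u : B, 0 ≤ ⟪S u, u⟫_ℝ) (h : ∀ u, R (R u) = S (S u)) : R = S := by
  let D : B →ₗ[ℝ] B := (R - S : B →L[ℝ] B)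
  have hD (u) : D u = R u - S u := rfl
  have hsym : D.IsSymmetric := fun u v => by
    simp only [hD, inner_sub_left, inner_sub_right, hR, hS]
  have key (i) : D (hsym.eigenvectorBasis rfl i) = 0 := by
    set e := hsym.eigenvectorBasis rfl i
    obtain ⟨c, hc⟩ : ∃ c : ℝ, D e = c • e := ⟨_, hsym.apply_eigenvectorBasis rfl i⟩
    have h1 : R (D e) + D (S e) = 0 := by
      simp only [hD, map_sub, h]
      abel
    have h2 : c * (⟪R e, e⟫_ℝ + ⟪S e, e⟫_ℝ) = 0 := by
      have := congrArg (fun x => ⟪x, e⟫_ℝ) h1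
      simp only [inner_add_left, inner_zero_left, hsym (S e) e, hc, map_smul, inner_smul_left,
        inner_smul_right] at this
      simpa [mul_add] using this
    rcases mul_eq_zero.1 h2 with h3 | h3
    · rw [hc, h3, zero_smul]
    · have h4 : ⟪D e, e⟫_ℝ = 0 := by
        rw [hD, inner_sub_left]
        linarith [hR0 e, hS0 e]
      rw [hc, inner_smul_left] at h4
      rcases mul_eq_zero.1 h4 with h5 | h5
      · rw [hc, show c = 0 by simpa using h5, zero_smul]
      · rw [inner_self_eq_zero.1 h5, map_zero]
  have hD0 : D = 0 := (hsym.eigenvectorBasis rfl).toBasis.ext fun i => by simpa using key i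
  ext u
  exact sub_eq_zero.1 (LinearMap.congr_fun hD0 u)

/-- The pairs `(U, R)` with `U` isometric and `R` self-adjoint and positive semidefinite. -/
def polarPairs (V B : Type*) [NormedAddCommGroup V] [InnerProductSpace ℝ V]
    [NormedAddCommGroup B] [InnerProductSpace ℝ B] : Set ((B →L[ℝ] V) × (B →L[ℝ] B)) :=
  {p | (∀ u, ‖p.1 u‖ = ‖u‖) ∧ (∀ u v, ⟪p.2 u, v⟫_ℝ = ⟪u, p.2 v⟫_ℝ) ∧ ∀ u, 0 ≤ ⟪p.2 u, u⟫_ℝ}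

/-- Semidefiniteness, unlike definiteness, is a closed condition; injectivity of the product
restores definiteness where it is needed. -/
lemma isClosed_polarPairs : IsClosed (polarPairs V B) := by
  simp only [polarPairs, Set.ofPred_and, Set.ofPred_forall]
  refine IsClosed.inter ?_ (IsClosed.inter ?_ ?_)
  · exact isClosed_iInter fun u => isClosed_eq (by fun_prop) (by fun_prop)
  · exact isClosed_iInter fun u => isClosed_iInter fun v => isClosed_eq (by fun_prop) (by fun_prop)
  · exact isClosed_iInter fun u => isClosed_le (by fun_prop) (by fun_prop)

lemma inner_map_map_of_norm_map {U : B →L[ℝ] V} (hU : ∀ u, ‖U u‖ = ‖u‖) (u v : B) :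
    ⟪U u, U v⟫_ℝ = ⟪u, v⟫_ℝ :=
  LinearIsometry.inner_map_map ⟨(U : B →ₗ[ℝ] V), hU⟩ u v

lemma inner_comp_self_of_mem_polarPairs {p : (B →L[ℝ] V) × (B →L[ℝ] B)} (hp : p ∈ polarPairs V B)
    (u v : B) : ⟪p.2 (p.2 u), v⟫_ℝ = ⟪(p.1 ∘L p.2) u, (p.1 ∘L p.2) v⟫_ℝ := by
  rw [hp.2.1]
  exact (inner_map_map_of_norm_map hp.1 _ _).symm

/-- The product determines `R²`, hence `R` as its nonnegative root; `R` is then invertible, which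
determines `U`. -/
lemma polarPairs_ext {p q : (B →L[ℝ] V) × (B →L[ℝ] B)} (hp : p ∈ polarPairs V B)
    (hq : q ∈ polarPairs V B) (h : p.1 ∘L p.2 = q.1 ∘L q.2)
    (hinj : Function.Injective (p.1 ∘L p.2)) : p = q := by
  have h2 : p.2 = q.2 := by
    refine eq_of_comp_self_eq hp.2.1 hp.2.2 hq.2.1 hq.2.2 fun u => ext_inner_right ℝ fun v => ?_
    rw [inner_comp_self_of_mem_polarPairs hp, inner_comp_self_of_mem_polarPairs hq, h]
  refine Prod.ext ?_ h2
  have hinj' : Function.Injective p.2 := Function.Injective.of_comp (f := p.1) hinj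
  have hsurj : Function.Surjective p.2 :=
    LinearMap.injective_iff_surjective (f := (p.2 : B →ₗ[ℝ] B)).1 hinj'
  ext u
  obtain ⟨v, rfl⟩ := hsurj u
  have := DFunLike.congr_fun h v
  rw [← h2] at this
  exact this

lemma IsPolarDecomposition.mem_polarPairs {F U : B →L[ℝ] V} {R : B →L[ℝ] B}
    (h : IsPolarDecomposition F U R) : (U, R) ∈ polarPairs V B :=
  ⟨h.mem_iso.1, h.selfAdjoint, fun u => by
    rcases eq_or_ne u 0 with rfl | hu
    · simp
    · exact (h.posDef u hu).le⟩

lemma IsPolarDecomposition.injective_right {F U : B →L[ℝ] V} {R : B →L[ℝ] B}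
    (h : IsPolarDecomposition F U R) : Function.Injective R := by
  refine (injective_iff_map_eq_zero R).2 fun u hu => ?_
  by_contra h0
  simpa [hu] using h.posDef u h0

lemma IsPolarDecomposition.injective {F U : B →L[ℝ] V} {R : B →L[ℝ] B}
    (h : IsPolarDecomposition F U R) : Function.Injective F := by
  refine (injective_iff_map_eq_zero F).2 fun u hu => ?_
  rw [h.eq_comp, ContinuousLinearMap.comp_apply] at hu
  rw [← norm_eq_zero, h.mem_iso.1, norm_eq_zero] at hu
  exact (injective_iff_map_eq_zero R).1 h.injective_right u hu

lemma IsPolarDecomposition.unique {F U U' : B →L[ℝ] V} {R R' : B →L[ℝ] B}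
    (h : IsPolarDecomposition F U R) (h' : IsPolarDecomposition F U' R') : U = U' ∧ R = R' :=
  Prod.ext_iff.1 <| polarPairs_ext h.mem_polarPairs h'.mem_polarPairs
    (h.eq_comp.symm.trans h'.eq_comp) (by simpa [← h.eq_comp] using h.injective)

/-- Singular values: an orthonormal eigenbasis `b` of `F* F` has orthogonal nonzero images. Let `U`
send `b i` to the normalised image `f i`, and let `R` scale `b i` by `‖F (b i)‖`. -/
lemma exists_isPolarDecomposition {F : B →L[ℝ] V} (hF : Function.Injective F) :
    ∃ U R, IsPolarDecomposition F U R := by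
  let T : B →ₗ[ℝ] B := (ContinuousLinearMap.adjoint F ∘L F : B →L[ℝ] B)
  have hT (u v) : ⟪T u, v⟫_ℝ = ⟪F u, F v⟫_ℝ := ContinuousLinearMap.adjoint_inner_left F v (F u)
  have hsym : T.IsSymmetric := fun u v => by
    rw [hT, real_inner_comm _ u, hT, real_inner_comm]
  let b := hsym.eigenvectorBasis rfl
  have hpos (i) : 0 < ‖F (b i)‖ := norm_pos_iff.2 fun h0 =>
    b.toBasis.ne_zero i (by simpa using (injective_iff_map_eq_zero F).1 hF _ h0)
  have hort (i j) (hij : i ≠ j) : ⟪F (b i), F (b j)⟫_ℝ = 0 := by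
    rw [← hT, hsym.apply_eigenvectorBasis rfl i, inner_smul_left, b.orthonormal.2 hij, mul_zero]
  let f (i) : V := ‖F (b i)‖⁻¹ • F (b i)
  have hf : Orthonormal ℝ f := by
    refine ⟨fun i => ?_, fun i j hij => ?_⟩
    · simp [f, norm_smul, (hpos i).ne']
    · simp [f, inner_smul_left, inner_smul_right, hort i j hij]
  let U : B →L[ℝ] V := ∑ i, (innerSL ℝ (b i)).smulRight (f i)
  let R : B →L[ℝ] B := ∑ i, (innerSL ℝ (b i)).smulRight (‖F (b i)‖ • b i)
  have hU (u) : U u = ∑ i, ⟪b i, u⟫_ℝ • f i := by simp [U]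
  have hR (u) : R u = ∑ i, ⟪b i, u⟫_ℝ • ‖F (b i)‖ • b i := by simp [R]
  have hRu (u v) : ⟪R u, v⟫_ℝ = ∑ i, ⟪b i, u⟫_ℝ * ‖F (b i)‖ * ⟪b i, v⟫_ℝ := by
    rw [hR, sum_inner]
    exact Finset.sum_congr rfl fun i _ => by simp [inner_smul_left, mul_assoc]
  have hUnorm (u) : ‖U u‖ = ‖u‖ := by
    rw [← sq_eq_sq₀ (norm_nonneg _) (norm_nonneg _), ← real_inner_self_eq_norm_sq, hU,
      hf.inner_sum, ← b.sum_sq_norm_inner_right u]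
    simp [sq]
  have hFUR : F = U ∘L R := by
    have : (F : B →ₗ[ℝ] V) = (U ∘L R : B →L[ℝ] V) := by
      refine b.toBasis.ext fun i => ?_
      have h1 : R (b i) = ‖F (b i)‖ • b i := by
        rw [hR, Finset.sum_eq_single i (fun j _ hj => by rw [b.orthonormal.2 hj, zero_smul])
          (by simp)]
        simp
      have h2 : U (b i) = f i := by
        rw [hU, Finset.sum_eq_single i (fun j _ hj => by rw [b.orthonormal.2 hj, zero_smul])
          (by simp)]
        simp
      simp [h1, h2, f, smul_smul, (hpos i).ne']
    exact ContinuousLinearMap.coe_injective this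
  refine ⟨U, R, hFUR, ⟨hUnorm, ?_⟩, fun u v => ?_, fun u hu => ?_⟩
  · have hUinj : Function.Injective U := (injective_iff_map_eq_zero U).2 fun u hu => by
      rw [← norm_eq_zero, ← hUnorm, hu, norm_zero]
    refine (Submodule.eq_of_le_of_finrank_eq ?_ ?_).symm
    · rw [hFUR]
      exact LinearMap.range_comp_le_range (R : B →ₗ[ℝ] B) (U : B →ₗ[ℝ] V)
    · rw [LinearMap.finrank_range_of_inj hF, LinearMap.finrank_range_of_inj hUinj]
  · rw [hRu, real_inner_comm, hRu]
    exact Finset.sum_congr rfl fun i _ => by ring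
  · rw [hRu]
    have h0 : 0 < ∑ i, ⟪b i, u⟫_ℝ ^ 2 := by
      have := b.sum_sq_norm_inner_right u
      simp only [Real.norm_eq_abs, sq_abs] at this
      rw [this]
      positivity
    obtain ⟨i, hi, hi0⟩ := Finset.exists_lt_of_sum_lt (f := fun _ => (0 : ℝ)) (by simpa using h0)
    refine Finset.sum_pos' (fun j _ => ?_) ⟨i, hi, ?_⟩
    · rw [mul_right_comm, ← sq]
      exact mul_nonneg (sq_nonneg _) (norm_nonneg _)
    · rw [mul_right_comm, ← sq]
      exact mul_pos hi0 (hpos i)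

/-- By the Lusin–Souslin theorem, the injective Borel map `(U, R) ↦ U R` on a Borel set of pairs is
a measurable embedding. Its inverse, extended measurably off the image, selects the polar factors.
-/
lemma exists_measurable_polar : ∃ (u : (B →L[ℝ] V) → B →L[ℝ] V) (r : (B →L[ℝ] V) → B →L[ℝ] B),
    Measurable u ∧ Measurable r ∧
      ∀ A, invNormSq A < ⊤ → IsPolarDecomposition A (u A) (r A) := by
  let S : Set ((B →L[ℝ] V) × (B →L[ℝ] B)) :=
    polarPairs V B ∩ (fun p => p.1 ∘L p.2) ⁻¹' {A | invNormSq A < ⊤}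
  have hcont : Continuous fun p : (B →L[ℝ] V) × (B →L[ℝ] B) => p.1 ∘L p.2 := by fun_prop
  have hS : MeasurableSet S := isClosed_polarPairs.measurableSet.inter
    (hcont.measurable (measurable_invNormSq measurableSet_Iio))
  have := hS.standardBorel
  have hemb : MeasurableEmbedding fun p : S => p.1.1 ∘L p.1.2 :=
    Measurable.measurableEmbedding (hcont.measurable.comp measurable_subtype_coe)
      fun p q h => Subtype.ext <|
        polarPairs_ext p.2.1 q.2.1 h (injective_of_invNormSq_lt_top p.2.2)
  obtain ⟨g, hg, hgS⟩ := hemb.exists_measurable_extend measurable_subtype_coe fun _ => ⟨(0, 0)⟩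
  refine ⟨fun A => (g A).1, fun A => (g A).2, hg.fst, hg.snd, fun A hA => ?_⟩
  obtain ⟨U, R, h⟩ := exists_isPolarDecomposition (injective_of_invNormSq_lt_top hA)
  have hm : (U, R) ∈ S := ⟨h.mem_polarPairs, by simpa [← h.eq_comp] using hA⟩
  have := congrFun hgS ⟨(U, R), hm⟩
  simp only [Function.comp_apply, ← h.eq_comp] at this
  simpa only [this] using h

lemma IsPolarDecomposition.comp_isometry {F U : B →L[ℝ] V} {R : B →L[ℝ] B}
    (h : IsPolarDecomposition F U R) (Q : V ≃ₗᵢ[ℝ] V) (O : B ≃ₗᵢ[ℝ] B) :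
    IsPolarDecomposition
      ((Q.toContinuousLinearEquiv : V →L[ℝ] V) ∘L F ∘L (O.toContinuousLinearEquiv : B →L[ℝ] B))
      ((Q.toContinuousLinearEquiv : V →L[ℝ] V) ∘L U ∘L (O.toContinuousLinearEquiv : B →L[ℝ] B))
      ((O.symm.toContinuousLinearEquiv : B →L[ℝ] B) ∘L R ∘L
        (O.toContinuousLinearEquiv : B →L[ℝ] B)) where
  eq_comp := by
    ext u
    simp [h.eq_comp]
  mem_iso := by
    refine ⟨fun u => by simp [h.mem_iso.1], ?_⟩
    have h1 (A : B →L[ℝ] V) : LinearMap.range (((Q.toContinuousLinearEquiv : V →L[ℝ] V) ∘L A ∘L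
        (O.toContinuousLinearEquiv : B →L[ℝ] B) : B →L[ℝ] V) : B →ₗ[ℝ] V) =
        (LinearMap.range (A : B →ₗ[ℝ] V)).map Q.toLinearEquiv.toLinearMap := by
      ext v
      simp only [LinearMap.mem_range, Submodule.mem_map]
      constructor
      · rintro ⟨u, rfl⟩
        exact ⟨_, ⟨O u, rfl⟩, rfl⟩
      · rintro ⟨_, ⟨u, rfl⟩, rfl⟩
        exact ⟨O.symm u, by simp⟩
    rw [h1, h1, h.mem_iso.2]
  selfAdjoint u v := by
    have h1 (x y) : ⟪O.symm x, y⟫_ℝ = ⟪x, O y⟫_ℝ := by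
      rw [← O.inner_map_map, O.apply_symm_apply]
    have h2 (x y) : ⟪x, O.symm y⟫_ℝ = ⟪O x, y⟫_ℝ := by
      rw [← O.inner_map_map, O.apply_symm_apply]
    simpa [h1, h2] using h.selfAdjoint _ _
  posDef u hu := by
    have h1 (x y) : ⟪O.symm x, y⟫_ℝ = ⟪x, O y⟫_ℝ := by
      rw [← O.inner_map_map, O.apply_symm_apply]
    simpa [h1] using h.posDef (O u) (by simpa using hu)

/-- `F R⁻¹ = U` is isometric, so a lower bound for `F` is an upper bound for `R⁻¹`. -/
lemma IsPolarDecomposition.norm_inverse_sq_le {F U : B →L[ℝ] V} {R : B →L[ℝ] B}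
    (h : IsPolarDecomposition F U R) (hF : invNormSq F < ⊤) :
    ‖R.inverse‖ ^ 2 ≤ (invNormSq F).toReal := by
  obtain ⟨e, he⟩ : ∃ e : B ≃L[ℝ] B, (e : B →L[ℝ] B) = R :=
    ⟨(LinearEquiv.ofInjectiveEndo (R : B →ₗ[ℝ] B) h.injective_right).toContinuousLinearEquiv, by
      ext; rfl⟩
  rw [← he, ContinuousLinearMap.inverse_equiv]
  refine (Real.le_sqrt (norm_nonneg _) ENNReal.toReal_nonneg).1
    (ContinuousLinearMap.opNorm_le_bound _ (Real.sqrt_nonneg _) fun v => ?_)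
  rw [← sq_le_sq₀ (norm_nonneg _) (by positivity), mul_pow, Real.sq_sqrt ENNReal.toReal_nonneg]
  have h1 := norm_sq_le_invNormSq_mul hF (e.symm v)
  have h2 : F (e.symm v) = U v := by
    rw [h.eq_comp, ← he]
    simp
  rwa [h2, h.mem_iso.1] at h1

/-- Inversion is continuous on the open set of units and takes the default value `0` elsewhere. -/
lemma measurable_inverse : Measurable (ContinuousLinearMap.inverse : (B →L[ℝ] B) → B →L[ℝ] B) := by
  have hU : IsOpen {R : B →L[ℝ] B | IsUnit R} := Units.isOpen
  rw [← ContinuousLinearMap.ringInverse_eq_inverse]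
  refine measurable_of_restrict_of_restrict_compl hU.measurableSet ?_ ?_
  · refine Continuous.measurable (continuous_iff_continuousAt.2 fun R => ?_)
    obtain ⟨R, x, rfl⟩ := R
    exact ContinuousAt.comp (f := Subtype.val) (x := (⟨x, x.isUnit⟩ : {R : B →L[ℝ] B | IsUnit R}))
      (NormedRing.inverse_continuousAt x) continuousAt_subtype_val
  · convert measurable_const (a := (0 : B →L[ℝ] B)) with R
    exact Ring.inverse_non_unit _ R.2

end Polar

/-! ### Uniqueness of uniformly distributed measures. -/

section UniformlyDistributed

open scoped ENNReal Topology
open Filter Metric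

variable {X : Type*} [PseudoMetricSpace X] [MeasurableSpace X] [BorelSpace X]
  [SecondCountableTopology X] {μ ν : Measure X} [IsProbabilityMeasure μ] [IsProbabilityMeasure ν]
  {S : Set X}

lemma measurableSet_dist_lt (r : ℝ) : MeasurableSet {p : X × X | dist p.1 p.2 < r} :=
  (isOpen_lt continuous_dist continuous_const).measurableSet

/-- Compute the `μ × ν` measure of `{dist < r}` in both orders: one gives the common `ν`-mass of
balls, the other the common `μ`-mass. -/
lemma measure_ball_eq_of_uniform (hμS : ∀ᵐ x ∂μ, x ∈ S) (hνS : ∀ᵐ x ∂ν, x ∈ S)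
    (hμ : ∀ x ∈ S, ∀ y ∈ S, ∀ r, μ (ball x r) = μ (ball y r))
    (hν : ∀ x ∈ S, ∀ y ∈ S, ∀ r, ν (ball x r) = ν (ball y r)) {x y : X} (hx : x ∈ S) (hy : y ∈ S)
    (r : ℝ) : μ (ball x r) = ν (ball y r) := by
  have h1 := Measure.prod_apply (μ := μ) (ν := ν) (measurableSet_dist_lt r)
  have h2 := Measure.prod_apply_symm (μ := μ) (ν := ν) (measurableSet_dist_lt r)
  have e1 : ∫⁻ z, ν (Prod.mk z ⁻¹' {p : X × X | dist p.1 p.2 < r}) ∂μ = ∫⁻ _, ν (ball y r) ∂μ := by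
    refine lintegral_congr_ae ?_
    filter_upwards [hμS] with z hz
    rw [← hν z hz y hy]
    congr 1
    ext w
    simp [dist_comm]
  have e2 : ∫⁻ z, μ ((fun w => (w, z)) ⁻¹' {p : X × X | dist p.1 p.2 < r}) ∂ν =
      ∫⁻ _, μ (ball x r) ∂ν := by
    refine lintegral_congr_ae ?_
    filter_upwards [hνS] with z hz
    rw [← hμ z hz x hx]
    rfl
  rw [e1] at h1
  rw [e2] at h2
  simpa using h2.symm.trans h1

/-- Otherwise all balls of radius `r` centred in `S` are null, and second countability makes `S`
null. -/
lemma measure_ball_pos_of_uniform (hμS : ∀ᵐ x ∂μ, x ∈ S)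
    (hμ : ∀ x ∈ S, ∀ y ∈ S, ∀ r, μ (ball x r) = μ (ball y r)) {x : X} (hx : x ∈ S) {r : ℝ}
    (hr : 0 < r) : 0 < μ (ball x r) := by
  refine pos_iff_ne_zero.2 fun h0 => ?_
  have h1 : μ S = 0 := measure_null_of_locally_null S fun y hy =>
    ⟨ball y r, mem_nhdsWithin_of_mem_nhds (ball_mem_nhds y hr), by rw [hμ y hy x hx, h0]⟩
  have h2 : ∀ᵐ _ ∂μ, False := by
    filter_upwards [hμS, measure_eq_zero_iff_ae_notMem.1 h1] with y h h' using h' h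
  exact NeZero.ne μ (ae_eq_bot.1 (eventually_false_iff_eq_bot.1 h2))

/-- Let `g n x` be the fraction of `ν` on the ball of radius `r n` about `x` that lies in `U`. By
Fubini its `μ`-integral is `ν U`, and at points of `U ∩ S` it is eventually `1`. Fatou's lemma
concludes. -/
lemma measure_open_le_of_uniform (hμS : ∀ᵐ x ∂μ, x ∈ S) (hνS : ∀ᵐ x ∂ν, x ∈ S)
    (hμ : ∀ x ∈ S, ∀ y ∈ S, ∀ r, μ (ball x r) = μ (ball y r))
    (hν : ∀ x ∈ S, ∀ y ∈ S, ∀ r, ν (ball x r) = ν (ball y r)) {U : Set X} (hU : IsOpen U) :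
    μ U ≤ ν U := by
  obtain ⟨x₀, hx₀⟩ := hμS.exists
  let r (n : ℕ) : ℝ := 1 / (n + 1)
  have hr (n) : 0 < r n := Nat.one_div_pos_of_nat
  let h (n : ℕ) : ℝ≥0∞ := ν (ball x₀ (r n))
  have h0 (n) : h n ≠ 0 := (measure_ball_pos_of_uniform hνS hν hx₀ (hr n)).ne'
  have htop (n) : h n ≠ ⊤ := measure_ne_top _ _
  have hT (n) : MeasurableSet {p : X × X | dist p.1 p.2 < r n ∧ p.2 ∈ U} :=
    (measurableSet_dist_lt _).inter (measurable_snd hU.measurableSet)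
  let g (n : ℕ) (x : X) : ℝ≥0∞ :=
    (h n)⁻¹ * ν (Prod.mk x ⁻¹' {p : X × X | dist p.1 p.2 < r n ∧ p.2 ∈ U})
  have hg (n) : Measurable (g n) := (measurable_measure_prodMk_left (hT n)).const_mul _
  have hgint (n) : ∫⁻ x, g n x ∂μ = ν U := by
    rw [lintegral_const_mul _ (measurable_measure_prodMk_left (hT n)), ← Measure.prod_apply (hT n),
      Measure.prod_apply_symm (hT n)]
    have : ∫⁻ y, μ ((fun x => (x, y)) ⁻¹' {p : X × X | dist p.1 p.2 < r n ∧ p.2 ∈ U}) ∂ν =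
        ∫⁻ y, U.indicator (fun _ => h n) y ∂ν := by
      refine lintegral_congr_ae ?_
      filter_upwards [hνS] with y hy
      by_cases hyU : y ∈ U
      · rw [Set.indicator_of_mem hyU]
        simp only [h]
        rw [← measure_ball_eq_of_uniform hμS hνS hμ hν hy hx₀ (r n)]
        congr 1
        ext x
        simp [hyU]
      · rw [Set.indicator_of_notMem hyU]
        convert measure_empty (μ := μ)
        ext x
        simp [hyU]
    rw [this, lintegral_indicator hU.measurableSet, setLIntegral_const, ← mul_assoc,
      ENNReal.inv_mul_cancel (h0 n) (htop n), one_mul]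
  calc μ U = ∫⁻ x, U.indicator (fun _ => 1) x ∂μ := by
        rw [lintegral_indicator hU.measurableSet, setLIntegral_one]
    _ ≤ ∫⁻ x, liminf (fun n => g n x) atTop ∂μ := by
        refine lintegral_mono_ae ?_
        filter_upwards [hμS] with x hx
        by_cases hxU : x ∈ U
        · rw [Set.indicator_of_mem hxU]
          obtain ⟨ε, hε, hball⟩ := Metric.isOpen_iff.1 hU x hxU
          refine le_liminf_of_le (by isBoundedDefault) ?_
          filter_upwards [tendsto_one_div_add_atTop_nhds_zero_nat.eventually (gt_mem_nhds hε)]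
            with n hn
          have : Prod.mk x ⁻¹' {p : X × X | dist p.1 p.2 < r n ∧ p.2 ∈ U} = ball x (r n) := by
            ext y
            simp only [Set.mem_preimage, Set.mem_ofPred_eq, mem_ball, dist_comm y x]
            refine ⟨fun h => h.1, fun h => ⟨h, hball ?_⟩⟩
            rw [mem_ball, dist_comm]
            exact h.trans hn
          simp only [g]
          rw [this, hν x hx x₀ hx₀, ENNReal.inv_mul_cancel (h0 n) (htop n)]
        · rw [Set.indicator_of_notMem hxU]
          exact zero_le
    _ ≤ liminf (fun n => ∫⁻ x, g n x ∂μ) atTop := lintegral_liminf_le hg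
    _ = ν U := by simp [hgint]

/-- Two probability measures that are uniformly distributed on the same set are equal. -/
lemma eq_of_uniform (hμS : ∀ᵐ x ∂μ, x ∈ S) (hνS : ∀ᵐ x ∂ν, x ∈ S)
    (hμ : ∀ x ∈ S, ∀ y ∈ S, ∀ r, μ (ball x r) = μ (ball y r))
    (hν : ∀ x ∈ S, ∀ y ∈ S, ∀ r, ν (ball x r) = ν (ball y r)) : μ = ν := by
  refine ext_of_generate_finite _ (BorelSpace.measurable_eq (α := X)) isPiSystem_isOpen
    (fun U hU => ?_) (by simp)
  exact le_antisymm (measure_open_le_of_uniform hμS hνS hμ hν hU)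
    (measure_open_le_of_uniform hνS hμS hν hμ hU)

end UniformlyDistributed

/-! ### Left-invariant laws of isometric maps and independence. -/

section Haar

open Metric

variable {V : Type*} [NormedAddCommGroup V] [InnerProductSpace ℝ V] [FiniteDimensional ℝ V]
variable {B : Type*} [NormedAddCommGroup B] [InnerProductSpace ℝ B] [FiniteDimensional ℝ B]

lemma exists_isometry_comp_eq {U U' : B →L[ℝ] V} (hU : ∀ u, ‖U u‖ = ‖u‖)
    (hU' : ∀ u, ‖U' u‖ = ‖u‖) :
    ∃ Q : V ≃ₗᵢ[ℝ] V, (Q.toContinuousLinearEquiv : V →L[ℝ] V) ∘L U = U' := by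
  let f : B →ₗᵢ[ℝ] V := ⟨(U : B →ₗ[ℝ] V), hU⟩
  let f' : B →ₗᵢ[ℝ] V := ⟨(U' : B →ₗ[ℝ] V), hU'⟩
  let L : LinearMap.range f.toLinearMap →ₗᵢ[ℝ] V := f'.comp f.equivRange.symm.toLinearIsometry
  refine ⟨L.extend.toLinearIsometryEquiv rfl, ?_⟩
  ext u
  have h1 : L.extend (f u) = L (f.equivRange u) := L.extend_apply (f.equivRange u)
  have h2 : L (f.equivRange u) = f' u := by simp [L]
  exact h1.trans h2

/-- Left composition with isometries of `V` is transitive on isometric maps and preserves the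
operator norm. An invariant measure thus gives equal mass to balls of equal radius centred at them.
-/
lemma eq_of_left_invariant {μ ν : Measure (B →L[ℝ] V)} [IsProbabilityMeasure μ]
    [IsProbabilityMeasure ν] (hμS : ∀ᵐ U ∂μ, ∀ u, ‖U u‖ = ‖u‖) (hνS : ∀ᵐ U ∂ν, ∀ u, ‖U u‖ = ‖u‖)
    (hμ : ∀ Q : V ≃ₗᵢ[ℝ] V, μ.map (fun U => (Q.toContinuousLinearEquiv : V →L[ℝ] V) ∘L U) = μ)
    (hν : ∀ Q : V ≃ₗᵢ[ℝ] V, ν.map (fun U => (Q.toContinuousLinearEquiv : V →L[ℝ] V) ∘L U) = ν) :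
    μ = ν := by
  have key (ρ : Measure (B →L[ℝ] V))
      (hρ : ∀ Q : V ≃ₗᵢ[ℝ] V, ρ.map (fun U => (Q.toContinuousLinearEquiv : V →L[ℝ] V) ∘L U) = ρ) :
      ∀ U ∈ {U : B →L[ℝ] V | ∀ u, ‖U u‖ = ‖u‖}, ∀ U' ∈ {U : B →L[ℝ] V | ∀ u, ‖U u‖ = ‖u‖},
        ∀ r, ρ (ball U r) = ρ (ball U' r) := by
    intro U hU U' hU' r
    obtain ⟨Q, hQ⟩ := exists_isometry_comp_eq hU hU'
    conv_rhs => rw [← hρ Q, Measure.map_apply (Continuous.measurable (by fun_prop))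
      measurableSet_ball]
    congr 1
    ext A
    have : ‖(Q.toContinuousLinearEquiv : V →L[ℝ] V) ∘L (A - U)‖ = ‖A - U‖ :=
      Q.toLinearIsometry.norm_toContinuousLinearMap_comp
    rw [ContinuousLinearMap.comp_sub, hQ] at this
    simp [dist_eq_norm, this]
  exact eq_of_uniform hμS hνS (key μ hμ) (key ν hν)

lemma measurableSet_isometric : MeasurableSet {U : B →L[ℝ] V | ∀ u, ‖U u‖ = ‖u‖} := by
  simp only [Set.ofPred_forall]
  exact (isClosed_iInter fun u => isClosed_eq (by fun_prop) (by fun_prop)).measurableSet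

/-- Conditioned on an event `R ∈ t` of positive probability, the law of `U` is still left invariant,
so by uniqueness it equals the unconditional law. -/
lemma indepFun_of_left_invariant {Ω β : Type*} [MeasurableSpace Ω] [MeasurableSpace β]
    {P : Measure Ω} [IsProbabilityMeasure P] {U : Ω → B →L[ℝ] V} {R : Ω → β}
    (hU : AEMeasurable U P) (hR : AEMeasurable R P) (hUS : ∀ᵐ s ∂P, ∀ u, ‖U s u‖ = ‖u‖)
    (h : ∀ Q : V ≃ₗᵢ[ℝ] V,
      P.map (fun s => ((Q.toContinuousLinearEquiv : V →L[ℝ] V) ∘L U s, R s)) =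
        P.map fun s => (U s, R s)) : IndepFun U R P := by
  let μ := P.map fun s => (U s, R s)
  have hμ : IsProbabilityMeasure μ := Measure.isProbabilityMeasure_map (hU.prodMk hR)
  have hQm (Q : V ≃ₗᵢ[ℝ] V) : Measurable fun A : B →L[ℝ] V =>
    (Q.toContinuousLinearEquiv : V →L[ℝ] V) ∘L A := Continuous.measurable (by fun_prop)
  have hinv (Q : V ≃ₗᵢ[ℝ] V) :
      μ.map (Prod.map (fun A => (Q.toContinuousLinearEquiv : V →L[ℝ] V) ∘L A) id) = μ := by
    rw [AEMeasurable.map_map_of_aemeasurable (((hQm Q).prodMap measurable_id).aemeasurable)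
      (hU.prodMk hR)]
    exact h Q
  have hiso : ∀ᵐ p ∂μ, p.1 ∈ {U : B →L[ℝ] V | ∀ u, ‖U u‖ = ‖u‖} :=
    (ae_map_iff (hU.prodMk hR) (measurable_fst measurableSet_isometric)).2 hUS
  have hfst : ∀ t, MeasurableSet t → μ (Prod.snd ⁻¹' t) ≠ 0 →
      (cond μ (Prod.snd ⁻¹' t)).map Prod.fst = μ.map Prod.fst := by
    intro t ht h0
    have hc : IsProbabilityMeasure (cond μ (Prod.snd ⁻¹' t)) := cond_isProbabilityMeasure h0
    have : IsProbabilityMeasure ((cond μ (Prod.snd ⁻¹' t)).map Prod.fst) :=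
      Measure.isProbabilityMeasure_map measurable_fst.aemeasurable
    have : IsProbabilityMeasure (μ.map Prod.fst) :=
      Measure.isProbabilityMeasure_map measurable_fst.aemeasurable
    have hpre (Q : V ≃ₗᵢ[ℝ] V) {s : Set (B →L[ℝ] V)} (hs : MeasurableSet s) {t : Set β}
        (ht : MeasurableSet t) : μ (Prod.snd ⁻¹' t ∩ Prod.fst ⁻¹'
          ((fun A => (Q.toContinuousLinearEquiv : V →L[ℝ] V) ∘L A) ⁻¹' s)) =
        μ (Prod.snd ⁻¹' t ∩ Prod.fst ⁻¹' s) := by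
      conv_rhs => rw [← hinv Q, Measure.map_apply ((hQm Q).prodMap measurable_id)
        ((measurable_snd ht).inter (measurable_fst hs))]
      rfl
    refine eq_of_left_invariant ((ae_map_iff measurable_fst.aemeasurable
      measurableSet_isometric).2 (cond_absolutelyContinuous.ae_le hiso))
      ((ae_map_iff measurable_fst.aemeasurable measurableSet_isometric).2 hiso)
      (fun Q => Measure.ext fun s hs => ?_) (fun Q => Measure.ext fun s hs => ?_)
    · rw [Measure.map_apply (hQm Q) hs, Measure.map_apply measurable_fst (hQm Q hs),
        Measure.map_apply measurable_fst hs, cond_apply (measurable_snd ht),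
        cond_apply (measurable_snd ht), hpre Q hs ht]
    · rw [Measure.map_apply (hQm Q) hs, Measure.map_apply measurable_fst (hQm Q hs),
        Measure.map_apply measurable_fst hs]
      simpa using hpre Q hs MeasurableSet.univ
  rw [indepFun_iff_map_prod_eq_prod_map_map hU hR]
  have hPU : P.map U = μ.map Prod.fst :=
    (AEMeasurable.map_map_of_aemeasurable measurable_fst.aemeasurable (hU.prodMk hR)).symm
  have hPR : P.map R = μ.map Prod.snd :=
    (AEMeasurable.map_map_of_aemeasurable measurable_snd.aemeasurable (hU.prodMk hR)).symm
  rw [hPU, hPR]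
  have : IsProbabilityMeasure (μ.map Prod.snd) :=
    Measure.isProbabilityMeasure_map measurable_snd.aemeasurable
  refine (Measure.prod_eq fun s t hs ht => ?_).symm
  have hst : s ×ˢ t = Prod.snd ⁻¹' t ∩ Prod.fst ⁻¹' s := by
    ext
    simp [and_comm]
  rw [Measure.map_apply measurable_snd ht, hst]
  rcases eq_or_ne (μ (Prod.snd ⁻¹' t)) 0 with h0 | h0
  · rw [h0, mul_zero]
    exact measure_mono_null Set.inter_subset_left h0
  · rw [← hfst t ht h0, Measure.map_apply measurable_fst hs, cond_apply (measurable_snd ht),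
      mul_comm, ← mul_assoc, ENNReal.mul_inv_cancel h0 (measure_ne_top _ _), one_mul]

end Haar

/-! ### Measurability on the space of subspaces. -/

section Grassmann

variable {V : Type*} [NormedAddCommGroup V] [InnerProductSpace ℝ V] [FiniteDimensional ℝ V]
variable {B : Type*} [NormedAddCommGroup B] [InnerProductSpace ℝ B] [FiniteDimensional ℝ B]

lemma measurable_starProjection :
    Measurable fun W : Submodule ℝ V => (W.starProjection : V →L[ℝ] V) :=
  comap_measurable _

lemma measurable_submodule_iff {α : Type*} [MeasurableSpace α] {f : α → Submodule ℝ V} :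
    Measurable f ↔ Measurable fun a => ((f a).starProjection : V →L[ℝ] V) :=
  measurable_comap_iff

lemma measurable_map_isometry (Q : V ≃ₗᵢ[ℝ] V) :
    Measurable fun W : Submodule ℝ V => W.map Q.toLinearEquiv.toLinearMap := by
  have h : (fun W : Submodule ℝ V => (W.map Q.toLinearEquiv.toLinearMap).starProjection) =
      fun W => (Q.toContinuousLinearEquiv : V →L[ℝ] V) ∘L W.starProjection ∘L
        (Q.symm.toContinuousLinearEquiv : V →L[ℝ] V) := by
    ext W v
    exact Submodule.starProjection_map_apply Q W v
  rw [measurable_submodule_iff, h]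
  have hc : Continuous fun A : V →L[ℝ] V => (Q.toContinuousLinearEquiv : V →L[ℝ] V) ∘L A ∘L
        (Q.symm.toContinuousLinearEquiv : V →L[ℝ] V) := by fun_prop
  exact hc.measurable.comp measurable_starProjection

/-- The dimension of a subspace is the trace of its orthogonal projection. -/
lemma measurableSet_Gr (ℓ : ℕ) : MeasurableSet (Gr V ℓ) := by
  let t : (V →L[ℝ] V) →ₗ[ℝ] ℝ := LinearMap.trace ℝ V ∘ₗ ContinuousLinearMap.coeLM ℝ
  have ht : Measurable fun W : Submodule ℝ V => t W.starProjection :=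
    (LinearMap.continuous_of_finiteDimensional t).measurable.comp measurable_starProjection
  have h : Gr V ℓ = (fun W : Submodule ℝ V => t W.starProjection) ⁻¹' {(ℓ : ℝ)} := by
    ext W
    have hW : LinearMap.IsProj W (W.starProjection : V →ₗ[ℝ] V) :=
      ⟨fun v => W.starProjection_apply_mem v, fun v hv => Submodule.starProjection_eq_self_iff.2 hv⟩
    have : t W.starProjection = finrank ℝ W := hW.trace
    simp [Gr, this]
  rw [h]
  exact ht (measurableSet_singleton _)

lemma starProjection_range_of_isometric {U : B →L[ℝ] V} (hU : ∀ u, ‖U u‖ = ‖u‖) :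
    (LinearMap.range (U : B →ₗ[ℝ] V)).starProjection = U ∘L ContinuousLinearMap.adjoint U := by
  ext v
  refine Submodule.eq_starProjection_of_mem_of_inner_eq_zero ⟨_, rfl⟩ ?_
  rintro _ ⟨u, rfl⟩
  have := inner_map_map_of_norm_map hU (ContinuousLinearMap.adjoint U v) u
  rw [ContinuousLinearMap.adjoint_inner_left] at this
  simp [inner_sub_left, this]

lemma continuous_comp_adjoint :
    Continuous fun U : B →L[ℝ] V => U ∘L ContinuousLinearMap.adjoint U :=
  continuous_id.clm_comp (ContinuousLinearMap.adjoint (𝕜 := ℝ) (E := B) (F := V)).continuous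

open Classical in
/-- The range of an isometric `U`, as a measurable function of `U`. -/
noncomputable def isometricRange (U : B →L[ℝ] V) : Submodule ℝ V :=
  if ∀ u, ‖U u‖ = ‖u‖ then LinearMap.range (U : B →ₗ[ℝ] V) else ⊥

lemma measurable_isometricRange : Measurable (isometricRange : (B →L[ℝ] V) → Submodule ℝ V) := by
  classical
  have h : (fun U : B →L[ℝ] V => (isometricRange U).starProjection) =
      fun U => if ∀ u, ‖U u‖ = ‖u‖ then U ∘L ContinuousLinearMap.adjoint U else 0 := by
    ext1 U
    by_cases hU : ∀ u, ‖U u‖ = ‖u‖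
    · simp only [isometricRange, if_pos hU, starProjection_range_of_isometric hU]
    · simp only [isometricRange, if_neg hU, Submodule.starProjection_bot]
  rw [measurable_submodule_iff, h]
  exact Measurable.ite measurableSet_isometric continuous_comp_adjoint.measurable measurable_const

lemma measurableSet_mem_Iso :
    MeasurableSet {p : Submodule ℝ V × (B →L[ℝ] V) | p.2 ∈ Iso B p.1} := by
  have h : {p : Submodule ℝ V × (B →L[ℝ] V) | p.2 ∈ Iso B p.1} =
      (Prod.snd ⁻¹' {U : B →L[ℝ] V | ∀ u, ‖U u‖ = ‖u‖}) ∩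
        {p | p.2 ∘L ContinuousLinearMap.adjoint p.2 = p.1.starProjection} := by
    ext p
    refine and_congr_right fun hU => ?_
    rw [← Submodule.starProjection_inj, starProjection_range_of_isometric hU]
    rfl
  rw [h]
  exact (measurable_snd measurableSet_isometric).inter (measurableSet_eq_fun
    (continuous_comp_adjoint.measurable.comp measurable_snd)
    (measurable_starProjection.comp measurable_fst))

end Grassmann

/-! ### Right invariance from a dense set of isometries. -/

section RightInvariance

variable {V : Type*} [NormedAddCommGroup V] [InnerProductSpace ℝ V] [FiniteDimensional ℝ V]
variable {B : Type*} [NormedAddCommGroup B] [InnerProductSpace ℝ B] [FiniteDimensional ℝ B]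

/-- Each isometry `O` gives invariance of the conditional law outside a null set depending on `O`.
Only countably many such sets can be discarded; integrals of bounded continuous functions depend
continuously on `T`, which recovers the rest. -/
lemma map_comp_right_eq_of_dense {ν : Measure (B →L[ℝ] V)} [IsProbabilityMeasure ν]
    {K : Set (B →L[ℝ] B)} {D : Set K} (hD : Dense D)
    (h : ∀ T ∈ D, ν.map (fun U => U ∘L (T : B →L[ℝ] B)) = ν) (T : K) :
    ν.map (fun U => U ∘L (T : B →L[ℝ] B)) = ν := by
  have hm (T : B →L[ℝ] B) : Measurable fun U : B →L[ℝ] V => U ∘L T :=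
    Continuous.measurable (by fun_prop)
  have hp (T : B →L[ℝ] B) : IsProbabilityMeasure (ν.map fun U => U ∘L T) :=
    Measure.isProbabilityMeasure_map (hm T).aemeasurable
  refine ext_of_forall_integral_eq_of_IsFiniteMeasure fun f => ?_
  have hi (T : B →L[ℝ] B) : ∫ U, f U ∂(ν.map fun U => U ∘L T) = ∫ U, f (U ∘L T) ∂ν :=
    integral_map (hm T).aemeasurable f.continuous.aestronglyMeasurable
  have hcont : Continuous fun T : K => ∫ U, f (U ∘L (T : B →L[ℝ] B)) ∂ν := by
    refine continuous_of_dominated (bound := fun _ => ‖f‖) (fun T => ?_)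
      (fun T => .of_forall fun U => f.norm_coe_le_norm _) (integrable_const _)
      (.of_forall fun U => ?_)
    · exact (f.continuous.measurable.comp (hm T)).aestronglyMeasurable
    · exact f.continuous.comp (continuous_const.clm_comp continuous_subtype_val)
  have := Continuous.ext_on hD hcont (continuous_const (y := ∫ U, f U ∂ν)) fun T hT => by
    rw [← hi, h T hT]
  rw [hi]
  exact congrFun this T

end RightInvariance

/-! ### From Gaussian to Haar–Grassmann sketching. -/

section Main

variable {V : Type*} [NormedAddCommGroup V] [InnerProductSpace ℝ V] [FiniteDimensional ℝ V]
variable {B : Type*} [NormedAddCommGroup B] [InnerProductSpace ℝ B] [FiniteDimensional ℝ B]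
variable {Ω : Type*} [MeasurableSpace Ω] {P : Measure Ω} {F : Ω → B →L[ℝ] V}

lemma GaussianSketching.lintegral_invNormSq_comp_lt_top (hF : GaussianSketching P F)
    (hd : finrank ℝ B + 1 < finrank ℝ V) : ∫⁻ s, invNormSq (F s) ∂P < ⊤ := by
  rw [← lintegral_map' measurable_invNormSq.aemeasurable hF.hasGaussianLaw.aemeasurable]
  exact hF.map.lintegral_invNormSq_lt_top hd

lemma GaussianSketching.ae_invNormSq_lt_top (hF : GaussianSketching P F)
    (hd : finrank ℝ B + 1 < finrank ℝ V) : ∀ᵐ s ∂P, invNormSq (F s) < ⊤ :=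
  ae_lt_top' (measurable_invNormSq.comp_aemeasurable hF.hasGaussianLaw.aemeasurable)
    (hF.lintegral_invNormSq_comp_lt_top hd).ne

lemma IsPolarDecomposition.isometricRange_eq {F U : B →L[ℝ] V} {R : B →L[ℝ] B}
    (h : IsPolarDecomposition F U R) : isometricRange U = LinearMap.range (F : B →ₗ[ℝ] V) := by
  rw [isometricRange, if_pos h.mem_iso.1, h.mem_iso.2]

lemma sketchRange_comp_isometry (Q : V ≃ₗᵢ[ℝ] V) (O : B ≃ₗᵢ[ℝ] B) (s : Ω) :
    sketchRange (fun s => (Q.toContinuousLinearEquiv : V →L[ℝ] V) ∘L F s ∘L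
        (O.toContinuousLinearEquiv : B →L[ℝ] B)) s =
      (sketchRange F s).map Q.toLinearEquiv.toLinearMap := by
  ext v
  simp only [sketchRange, LinearMap.mem_range, Submodule.mem_map]
  constructor
  · rintro ⟨u, rfl⟩
    exact ⟨_, ⟨O u, rfl⟩, rfl⟩
  · rintro ⟨_, ⟨u, rfl⟩, rfl⟩
    exact ⟨O.symm u, by simp⟩

/-- The random sketch, jointly with its range and its polar factors, is invariant in law under
linear isometries. -/
lemma GaussianSketching.map_polar_comp_isometry (hF : GaussianSketching P F)
    (hd : finrank ℝ B + 1 < finrank ℝ V) {u : (B →L[ℝ] V) → B →L[ℝ] V}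
    {r : (B →L[ℝ] V) → B →L[ℝ] B} (hu : Measurable u) (hr : Measurable r)
    (hur : ∀ A, invNormSq A < ⊤ → IsPolarDecomposition A (u A) (r A)) (Q : V ≃ₗᵢ[ℝ] V)
    (O : B ≃ₗᵢ[ℝ] B) :
    P.map (fun s => ((sketchRange F s).map Q.toLinearEquiv.toLinearMap,
      (Q.toContinuousLinearEquiv : V →L[ℝ] V) ∘L u (F s) ∘L
        (O.toContinuousLinearEquiv : B →L[ℝ] B),
      (O.symm.toContinuousLinearEquiv : B →L[ℝ] B) ∘L r (F s) ∘L
        (O.toContinuousLinearEquiv : B →L[ℝ] B))) =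
      P.map fun s => (sketchRange F s, u (F s), r (F s)) := by
  have hF' := hF.comp_isometry Q O
  have hg : Measurable fun A => (isometricRange (u A), u A, r A) :=
    (measurable_isometricRange.comp hu).prodMk (hu.prodMk hr)
  have h1 : P.map (fun s => (sketchRange F s, u (F s), r (F s))) =
      (P.map F).map fun A => (isometricRange (u A), u A, r A) := by
    rw [AEMeasurable.map_map_of_aemeasurable hg.aemeasurable hF.hasGaussianLaw.aemeasurable]
    refine Measure.map_congr ?_
    filter_upwards [hF.ae_invNormSq_lt_top hd] with s hs
    simp only [Function.comp_apply, (hur _ hs).isometricRange_eq]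
    rfl
  rw [h1, hF.map_eq hF',
    AEMeasurable.map_map_of_aemeasurable hg.aemeasurable hF'.hasGaussianLaw.aemeasurable]
  refine Measure.map_congr ?_
  filter_upwards [hF.ae_invNormSq_lt_top hd, hF'.ae_invNormSq_lt_top hd] with s hs hs'
  obtain ⟨e1, e2⟩ := (hur _ hs').unique ((hur _ hs).comp_isometry Q O)
  have e3 := (hur _ hs').isometricRange_eq
  rw [e1] at e3
  simp only [Function.comp_apply, e1, e2, e3]
  rw [← sketchRange_comp_isometry Q O s]
  rfl

lemma GaussianSketching.integral_inner_map_map (hF : GaussianSketching P F) (u v : B) :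
    ∫ s, ⟪F s u, F s v⟫_ℝ ∂P = finrank ℝ V * ⟪u, v⟫_ℝ := by
  let f := stdOrthonormalBasis ℝ V
  have h (s : Ω) : ⟪F s u, F s v⟫_ℝ = ∑ k, ⟪F s u, f k⟫_ℝ * ⟪F s v, f k⟫_ℝ := by
    rw [← f.sum_inner_mul_inner]
    simp_rw [real_inner_comm (F s v)]
  simp_rw [h]
  have hi (k) : Integrable (fun s => ⟪F s u, f k⟫_ℝ * ⟪F s v, f k⟫_ℝ) P :=
    (hF.memLp_coeff u (f k)).integrable_mul (hF.memLp_coeff v (f k))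
  rw [integral_finsetSum _ fun k _ => hi k]
  simp [hF.covariance]

theorem GaussianSketching.haarGrassmannSketching [IsProbabilityMeasure P]
    (hF : GaussianSketching P F) (hd : finrank ℝ B + 1 < finrank ℝ V) :
    HaarGrassmannSketching P F := by
  obtain ⟨u, r, hu, hr, hur⟩ := exists_measurable_polar (V := V) (B := B)
  have hFm := hF.hasGaussianLaw.aemeasurable
  have hfin := hF.ae_invNormSq_lt_top hd
  have hpol : ∀ᵐ s ∂P, IsPolarDecomposition (F s) (u (F s)) (r (F s)) := hfin.mono fun s => hur _
  have hU : AEMeasurable (fun s => u (F s)) P := hu.comp_aemeasurable hFm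
  have hR : AEMeasurable (fun s => r (F s)) P := hr.comp_aemeasurable hFm
  have hΞ : AEMeasurable (sketchRange F) P :=
    (measurable_isometricRange.comp_aemeasurable hU).congr (hpol.mono fun s h => h.isometricRange_eq)
  have hinv := hF.map_polar_comp_isometry hd hu hr hur
  have hrank : ∀ᵐ s ∂P, finrank ℝ (LinearMap.range (F s : B →ₗ[ℝ] V)) = finrank ℝ B :=
    hpol.mono fun s h => LinearMap.finrank_range_of_inj h.injective
  have hcomp (T : B →L[ℝ] B) : Measurable fun A : B →L[ℝ] V => A ∘L T :=
    Continuous.measurable (by fun_prop)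
  have hQcomp (Q : V ≃ₗᵢ[ℝ] V) : Measurable fun A : B →L[ℝ] V =>
    (Q.toContinuousLinearEquiv : V →L[ℝ] V) ∘L A := Continuous.measurable (by fun_prop)
  have hRR : AEMeasurable (fun s => r (F s) ∘L r (F s)) P :=
    Measurable.comp_aemeasurable (g := fun A : B →L[ℝ] B => A ∘L A)
      (continuous_id.clm_comp continuous_id).measurable hR
  have hRRi : Integrable (fun s => r (F s) ∘L r (F s)) P := by
    refine (hF.hasGaussianLaw.memLp_two.integrable_norm_pow two_ne_zero).mono'
      hRR.aestronglyMeasurable ?_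
    filter_upwards [hpol] with s h
    -- `U` is isometric, so `‖R v‖ = ‖F v‖`; square integrability of the Gaussian `F` then dominates
    -- `R²`.
    have h1 : ‖r (F s)‖ ≤ ‖F s‖ := by
      refine ContinuousLinearMap.opNorm_le_bound _ (norm_nonneg _) fun v => ?_
      have h2 : F s v = u (F s) (r (F s) v) := DFunLike.congr_fun h.eq_comp v
      rw [← h.mem_iso.1, ← h2]
      exact (F s).le_opNorm v
    exact (ContinuousLinearMap.opNorm_comp_le _ _).trans
      (by rw [sq]; exact mul_le_mul h1 h1 (norm_nonneg _) (norm_nonneg _))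
  refine ⟨hΞ, ⟨Measure.isProbabilityMeasure_map hΞ, (ae_map_iff hΞ (measurableSet_Gr _)).2 hrank,
    fun Q => ?_⟩, hrank, fun s => u (F s), fun s => r (F s), hU, hR, hpol, ?_, ?_, hRRi, ?_, ?_⟩
  · have h := congrArg (Measure.map Prod.fst) (hinv Q (.refl ℝ B))
    rw [AEMeasurable.map_map_of_aemeasurable measurable_fst.aemeasurable,
      AEMeasurable.map_map_of_aemeasurable measurable_fst.aemeasurable] at h
    · rw [AEMeasurable.map_map_of_aemeasurable (measurable_map_isometry Q).aemeasurable hΞ]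
      exact h
    · exact hΞ.prodMk (hU.prodMk hR)
    · exact ((measurable_map_isometry Q).comp_aemeasurable hΞ).prodMk
        (((hQcomp Q).comp_aemeasurable hU).prodMk hR)
  · let κ := condDistrib (fun s => u (F s)) (sketchRange F) P
    let K : Set (B →L[ℝ] B) :=
      Set.range fun O : B ≃ₗᵢ[ℝ] B => (O.toContinuousLinearEquiv : B →L[ℝ] B)
    obtain ⟨D, hDc, hD⟩ := TopologicalSpace.exists_countable_dense K
    have hO (O : B ≃ₗᵢ[ℝ] B) : ∀ᵐ W ∂(P.map (sketchRange F)),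
        (κ W).map (fun U => U ∘L (O.toContinuousLinearEquiv : B →L[ℝ] B)) = κ W := by
      have hUO := (hcomp (O.toContinuousLinearEquiv : B →L[ℝ] B)).comp_aemeasurable hU
      have h1 := condDistrib_comp (mβ := subspaceMeasurableSpace) (sketchRange F) hU
        (hcomp (O.toContinuousLinearEquiv : B →L[ℝ] B))
      -- `(Ξ, U O)` and `(Ξ, U)` have the same joint law, so `κ` is also a conditional law of `U O`
      -- given `Ξ`.
      have h2 := condDistrib_ae_eq_of_measure_eq_compProd (sketchRange F) hUO (κ := κ) (by
        rw [compProd_map_condDistrib hU]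
        have hm : Measurable fun p : Submodule ℝ V × (B →L[ℝ] V) × (B →L[ℝ] B) => (p.1, p.2.1) :=
          measurable_fst.prodMk measurable_snd.fst
        have h := congrArg (Measure.map fun p => (p.1, p.2.1)) (hinv (.refl ℝ V) O)
        rw [AEMeasurable.map_map_of_aemeasurable hm.aemeasurable,
          AEMeasurable.map_map_of_aemeasurable hm.aemeasurable (hΞ.prodMk (hU.prodMk hR))] at h
        · refine Eq.trans ?_ h
          congr 1
          ext1 s
          refine Prod.ext ?_ rfl
          exact (Submodule.map_id _).symm
        · exact ((measurable_map_isometry (.refl ℝ V)).comp_aemeasurable hΞ).prodMk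
            (hUO.prodMk (Measurable.comp_aemeasurable (g := fun A : B →L[ℝ] B =>
              (O.symm.toContinuousLinearEquiv : B →L[ℝ] B) ∘L A ∘L
                (O.toContinuousLinearEquiv : B →L[ℝ] B))
              (Continuous.measurable (by fun_prop)) hR)))
      filter_upwards [h1, h2] with W h1 h2
      rw [← Kernel.map_apply _ (hcomp _), ← h1]
      exact h2
    have hall : ∀ᵐ W ∂(P.map (sketchRange F)), ∀ T ∈ D,
        (κ W).map (fun U => U ∘L (T : B →L[ℝ] B)) = κ W :=
      (ae_ball_iff hDc).2 fun T _ => by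
        obtain ⟨O, hOT⟩ := T.2
        rw [← hOT]
        exact hO O
    have hmem : ∀ᵐ W ∂(P.map (sketchRange F)), ∀ᵐ U ∂(κ W), U ∈ Iso B W :=
      Measure.ae_ae_of_ae_compProd (p := fun p => p.2 ∈ Iso B p.1) (by
        rw [compProd_map_condDistrib hU]
        exact (ae_map_iff (hΞ.prodMk hU) measurableSet_mem_Iso).2 (hpol.mono fun s h => h.mem_iso))
    filter_upwards [hall, hmem] with W h1 h2
    exact ⟨inferInstance, h2, fun O => map_comp_right_eq_of_dense hD h1 ⟨_, O, rfl⟩⟩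
  · refine indepFun_of_left_invariant hU hR (hpol.mono fun s h => h.mem_iso.1) fun Q => ?_
    have h := congrArg (Measure.map Prod.snd) (hinv Q (.refl ℝ B))
    rw [AEMeasurable.map_map_of_aemeasurable measurable_snd.aemeasurable,
      AEMeasurable.map_map_of_aemeasurable measurable_snd.aemeasurable] at h
    · exact h
    · exact hΞ.prodMk (hU.prodMk hR)
    · exact ((measurable_map_isometry Q).comp_aemeasurable hΞ).prodMk
        (((hQcomp Q).comp_aemeasurable hU).prodMk hR)
  · ext v
    refine ext_inner_right ℝ fun w => ?_
    have h1 := (coeff v w).integral_comp_comm hRRi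
    rw [coeff_apply] at h1
    rw [← h1]
    -- Almost surely `⟪R² v, w⟫ = ⟪F v, F w⟫`, so the mean of `R²` needs only the covariance of `F`.
    have h2 : ∫ s, coeff v w (r (F s) ∘L r (F s)) ∂P = ∫ s, ⟪F s v, F s w⟫_ℝ ∂P := by
      refine integral_congr_ae ?_
      filter_upwards [hpol] with s h
      rw [coeff_apply]
      have := inner_comp_self_of_mem_polarPairs h.mem_polarPairs v w
      rw [← h.eq_comp] at this
      exact this
    rw [h2, hF.integral_inner_map_map]
    simp [inner_smul_left]
  · have hi : Integrable (fun s => (invNormSq (F s)).toReal) P :=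
      integrable_toReal_of_lintegral_ne_top (measurable_invNormSq.comp_aemeasurable hFm)
        (hF.lintegral_invNormSq_comp_lt_top hd).ne
    refine hi.mono'
      ((measurable_inverse.comp_aemeasurable hR).norm.pow_const 2).aestronglyMeasurable ?_
    filter_upwards [hpol, hfin] with s h hs
    rw [Real.norm_of_nonneg (by positivity)]
    exact h.norm_inverse_sq_le hs

end Main

end Sketching

theorem mainTheorem6 {d : ℕ} {M : Type*} [TopologicalSpace M]
    [ChartedSpace (EuclideanSpace ℝ (Fin d)) M] [IsManifold (𝓡 d) ∞ M]
    [Bundle.RiemannianBundle (fun x : M => TangentSpace (𝓡 d) x)]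
    [IsContMDiffRiemannianBundle (𝓡 d) ∞ (EuclideanSpace ℝ (Fin d))
      (fun x : M => TangentSpace (𝓡 d) x)]
    {Ω : Type*} [MeasurableSpace Ω] (P : Measure Ω) [IsProbabilityMeasure P]
    (x : M) (B : Submodule ℝ (TangentSpace (𝓡 d) x)) (ℓ : ℕ) (hB : finrank ℝ B = ℓ)
    (hd : ℓ + 1 < d) (F : Ω → B →L[ℝ] TangentSpace (𝓡 d) x)
    (hF : Sketching.GaussianSketching P F) :
    Sketching.HaarGrassmannSketching P F := by
  have hV : finrank ℝ (TangentSpace (𝓡 d) x) = d := finrank_euclideanSpace_fin (𝕜 := ℝ) (n := d)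
  exact hF.haarGrassmannSketching (by rw [hB, hV]; exact hd)
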